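/- \textbf{Setting.} Place a qubit on every edge of the cubic lattice $\Gamma=\mathbb{Z}^3$, and let $\mathfrak{A}$ be the quasi-local $C^*$-algebra, the norm closure of the algebra of observables acting on finitely many qubits. For a vertex $v$ and a face $f$ put $A_v=\prod_{e\ni v}\sigma^x_e$ and $B_f=\prod_{e\in f}\sigma^z_e$. For a finite set $\Lambda$ of edges let $H_\Lambda=\sum_{v}(1-A_v)+\sum_{f}(1-B_f)$, summed over the vertices and faces all of whose edges lie in $\Lambda$. Let $\delta$ be the closure of the derivation $\delta(O)=\lim_{\Lambda}i[H_\Lambda,O]$ on local observables $O$. A state $\varphi$ on $\mathfrak{A}$ is a \emph{ground state} if $-i\,\varphi(O^*\delta(O))\ge 0$ for all $O$ in the domain of $\delta$. An \emph{infinite path} in the dual lattice $\overline\Gamma$ is a map $\bar\gamma$ from $\mathbb{Z}$ to the oriented edges of $\overline\Gamma$ such that the end vertex of $\bar\gamma(t)$ is the start vertex of $\bar\gamma(t+1)$ for all $t$ and the path does not intersect itself (no proper nonempty part of a finite section has zero boundary). It is \emph{monotonic} if for each axis $r\in\{x,y,z\}$ there is a sign $\sigma_r$ such that every edge of $\bar\gamma$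 along axis $r$ points in the direction $(r,\sigma_r)$. For a finite set $S$ of faces of $\overline\Gamma$ let $F_S$ be the product of $\sigma^x_e$ over the edges $e$ of $\Gamma$ dual to the faces in $S$, and let $\partial S$ be the set of dual edges contained in an odd number of faces of $S$. Say that an increasing sequence $(S_n)$ of finite sets of dual faces \emph{bounds} $\bar\gamma$ if each dual edge lies, for all large $n$, in $\partial S_n$ if and only if it lies on $\bar\gamma$. \textbf{Theorem.} There is a state $\omega$ on $\mathfrak{A}$ with $\omega(A_v)=\omega(B_f)=1$ for all $v$ and $f$. Let $\omega$ be any such state and let $\bar\gamma$ be an infinite path in $\overline\Gamma$. Then there is a sequence $(S_n)$ that bounds $\bar\gamma$; and for every sequence $(S_n)$ that bounds $\bar\gamma$, the limit $\alpha_{\bar\gamma}(O)=\lim_{n\to\infty}F_{S_n}\,O\,F_{S_n}$ exists in norm for all $O\in\mathfrak{A}$ and defines a $*$-automorphism of $\mathfrak{A}$, and the state $\omega_{\bar\gamma}=\omega\circ\alpha_{\bar\gamma}$ is a ground state if and only if $\bar\gamma$ is monotonic. -/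

import Mathlib

open Filter Topology
open scoped ComplexOrder

namespace ToricCode3D

noncomputable section

/-! ### The cubic cell complex

Both the lattice and its dual lattice are copies of the cell complex `ℤ³`. -/

/-- Vertices of `ℤ³`. -/
abbrev Vertex : Type := Fin 3 → ℤ

/-- The unit vector in direction `i`. -/
def unit (i : Fin 3) : Vertex := Pi.single i 1

/-- Edges of `ℤ³`: `(v, i)` is the edge joining `v` and `v + unit i`. -/
abbrev Edge : Type := Vertex × Fin 3

/-- Faces of `ℤ³`: `(v, k)` is the unit square with normal direction `k` whose corners are
`v`, `v + unit (k + 1)`, `v + unit (k + 2)`, `v + unit (k + 1) + unit (k + 2)`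
(indices modulo 3). -/
abbrev Face : Type := Vertex × Fin 3

/-- The six edges that contain the vertex `v`. -/
def starEdges (v : Vertex) : Finset Edge :=
  Finset.univ.image (fun i : Fin 3 => ((v, i) : Edge)) ∪
    Finset.univ.image (fun i : Fin 3 => ((v - unit i, i) : Edge))

/-- The four edges of the face `f`. -/
def faceEdges (f : Face) : Finset Edge :=
  {(f.1, f.2 + 1), (f.1, f.2 + 2),
    (f.1 + unit (f.2 + 1), f.2 + 2), (f.1 + unit (f.2 + 2), f.2 + 1)}

/-- The edge of the lattice that is dual to a face of the dual lattice. The dual vertex `w` sits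
at the point `w + (1/2, 1/2, 1/2)`, so the dual face `(w, k)` is crossed at its centre by the edge
`(w + unit (k + 1) + unit (k + 2), k)`. -/
def edgeOfDualFace (f : Face) : Edge := (f.1 + unit (f.2 + 1) + unit (f.2 + 2), f.2)

/-- The edge of the dual lattice that crosses the face `f` of the lattice. -/
def dualEdgeOfFace (f : Face) : Edge := (f.1 - unit f.2, f.2)

/-- Compatibility of the two duality maps: the edge dual to `g` lies in `f` if and only if the
dual edge crossing `f` lies in the dual face `g`. -/
theorem edgeOfDualFace_mem_faceEdges (f g : Face) :
    edgeOfDualFace g ∈ faceEdges f ↔ dualEdgeOfFace f ∈ faceEdges g := by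
  obtain ⟨v, k⟩ := f
  obtain ⟨w, l⟩ := g
  fin_cases k <;> fin_cases l <;>
    simp [edgeOfDualFace, dualEdgeOfFace, faceEdges, unit, funext_iff, Fin.forall_fin_succ,
      Pi.single_apply] <;> omega

/-! ### Paths in the dual lattice -/

/-- An edge together with one of its two orientations; `forward = true` means that it points in
the positive direction of its axis. -/
structure OrientedEdge where
  edge : Edge
  forward : Bool

namespace OrientedEdge

/-- The start vertex of an oriented edge. -/
def source (e : OrientedEdge) : Vertex :=
  if e.forward then e.edge.1 else e.edge.1 + unit e.edge.2

/-- The end vertex of an oriented edge. -/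
def target (e : OrientedEdge) : Vertex :=
  if e.forward then e.edge.1 + unit e.edge.2 else e.edge.1

/-- The boundary `target - source`, a formal integer combination of vertices. -/
def boundary (e : OrientedEdge) : Vertex →₀ ℤ :=
  Finsupp.single e.target 1 - Finsupp.single e.source 1

/-- All oriented edges that point in the direction `(r, σ)`. -/
def pointing (r : Fin 3) (σ : Bool) : Set OrientedEdge :=
  {e | e.edge.2 = r ∧ e.forward = σ}

end OrientedEdge

/-- Finite paths: consecutive edges are composable, and no nonempty proper part of the path has
vanishing boundary (no self-intersection; the whole path may be closed). -/
def IsFinitePath {l : ℕ} (e : Fin l → OrientedEdge) : Prop :=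
  (∀ i j : Fin l, (j : ℕ) = i + 1 → (e i).target = (e j).source) ∧
    ∀ s : Finset (Fin l), s.Nonempty → s ≠ Finset.univ → ∑ i ∈ s, (e i).boundary ≠ 0

/-- Infinite paths: functions on `ℤ` all of whose finite sections are finite paths. -/
structure InfinitePath where
  toFun : ℤ → OrientedEdge
  isFinitePath : ∀ (a : ℤ) (l : ℕ), IsFinitePath (fun i : Fin l => toFun (a + (i : ℕ)))

/-- The set of (unoriented) edges that an infinite path runs through. -/
def InfinitePath.edges (γ : InfinitePath) : Set Edge := {e | ∃ t : ℤ, (γ.toFun t).edge = e}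

/-- Monotonic paths: along each axis only one sign is used. -/
def InfinitePath.IsMonotonic (γ : InfinitePath) : Prop :=
  ∃ σ : Fin 3 → Bool, Set.range γ.toFun ⊆ ⋃ r : Fin 3, OrientedEdge.pointing r (σ r)

/-- The boundary of a finite set of faces: the edges contained in an odd number of them. -/
def surfaceBoundary (S : Finset Face) : Set Edge := {e | Odd (S.filter (e ∈ faceEdges ·)).card}

/-- An increasing sequence of finite surfaces in the dual lattice whose boundaries converge to the
infinite path `γ`: each dual edge eventually lies in the boundary of `S n` exactly if it lies on
`γ`, so every finite section of `γ` is eventually part of the boundary and the remaining part of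
the boundary moves off to infinity. -/
def BoundsPath (γ : InfinitePath) (S : ℕ → Finset Face) : Prop :=
  Monotone S ∧ ∀ e : Edge, ∀ᶠ n in atTop, (e ∈ surfaceBoundary (S n) ↔ e ∈ γ.edges)

/-! ### The quasi-local algebra

The qubits are represented on the Hilbert space with orthonormal basis the configurations with
finitely many down spins (a configuration is the finite set of edges where `σᶻ = -1`). For finite
`Λ` the operators acting on the qubits in `Λ` form a faithful copy `B(ℋ_Λ) ⊗ 1` of the full matrix
algebra, generated by the Pauli matrices `σˣ`, `σᶻ` at the edges in `Λ`; hence the norm closure of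
the union of these algebras is the usual quasi-local algebra. -/

/-- The Hilbert space spanned by configurations with finitely many down spins. -/
abbrev Hilb : Type := lp (fun _ : Finset Edge => ℂ) 2

/-- The operator `(U f) s = c s * f (p s)`, for a permutation `p` of the configurations and signs
`c`. -/
def monomialOp (p : Equiv.Perm (Finset Edge)) (c : Finset Edge → ℤˣ) : Hilb →L[ℂ] Hilb :=
  LinearMap.mkContinuous
    { toFun := fun f =>
        ⟨fun s => ((c s : ℤ) : ℂ) * f (p s), by
          have hf := lp.memℓp f
          change Memℓp _ _
          rw [memℓp_gen_iff (by norm_num)] at hf ⊢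
          have h := (p.summable_iff).2 hf
          refine h.congr fun s => ?_
          rcases Int.units_eq_one_or (c s) with h1 | h1 <;> simp [h1]⟩
      map_add' := fun f g => by
        ext s
        exact mul_add _ _ _
      map_smul' := fun a f => by
        ext s
        exact mul_left_comm _ _ _ }
    1 (fun f => by
      rw [one_mul]
      apply le_of_eq
      rw [lp.norm_eq_tsum_rpow (by norm_num), lp.norm_eq_tsum_rpow (by norm_num)]
      congr 1
      rw [← p.tsum_eq (fun s => ‖f s‖ ^ (2 : ENNReal).toReal)]
      refine tsum_congr fun s => ?_
      rcases Int.units_eq_one_or (c s) with h1 | h1 <;> simp [h1])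

theorem monomialOp_apply (p : Equiv.Perm (Finset Edge)) (c : Finset Edge → ℤˣ) (f : Hilb)
    (s : Finset Edge) : monomialOp p c f s = ((c s : ℤ) : ℂ) * f (p s) := rfl

/-- Flipping all spins in `T`. -/
def flipPerm (T : Finset Edge) : Equiv.Perm (Finset Edge) where
  toFun s := symmDiff s T
  invFun s := symmDiff s T
  left_inv s := symmDiff_symmDiff_cancel_right T s
  right_inv s := symmDiff_symmDiff_cancel_right T s

/-- The operator `∏_{e ∈ T} σˣ_e` flipping all spins in `T`. -/
def opX (T : Finset Edge) : Hilb →L[ℂ] Hilb := monomialOp (flipPerm T) (fun _ => 1)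

/-- The operator `∏_{e ∈ T} σᶻ_e`, with eigenvalue `(-1) ^ #(s ∩ T)` at the configuration `s`. -/
def opZ (T : Finset Edge) : Hilb →L[ℂ] Hilb :=
  monomialOp (Equiv.refl _) (fun s => (-1) ^ (s ∩ T).card)

/-- The Pauli matrix `σˣ` at the edge `e`. -/
def sigmaX (e : Edge) : Hilb →L[ℂ] Hilb := opX {e}

/-- The Pauli matrix `σᶻ` at the edge `e`. -/
def sigmaZ (e : Edge) : Hilb →L[ℂ] Hilb := opZ {e}

theorem opX_empty : opX ∅ = 1 := by
  ext f s
  have h : symmDiff s ∅ = s := symmDiff_bot s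
  simp [opX, monomialOp_apply, flipPerm, h]

theorem opZ_empty : opZ ∅ = 1 := by
  ext f s
  simp [opZ, monomialOp_apply]

theorem opX_insert {e : Edge} {T : Finset Edge} (he : e ∉ T) :
    opX (insert e T) = sigmaX e * opX T := by
  ext f s
  have h : insert e T = symmDiff {e} T := by
    rw [(Finset.disjoint_singleton_left.2 he).symmDiff_eq_sup]
    rfl
  simp [opX, sigmaX, monomialOp_apply, flipPerm, h, symmDiff_assoc]

theorem opZ_insert {e : Edge} {T : Finset Edge} (he : e ∉ T) :
    opZ (insert e T) = sigmaZ e * opZ T := by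
  ext f s
  have h : (s ∩ insert e T).card = (s ∩ {e}).card + (s ∩ T).card := by
    rw [Finset.insert_eq, Finset.inter_union_distrib_left, Finset.card_union_of_disjoint]
    exact (Finset.disjoint_singleton_left.2 he).mono Finset.inter_subset_right
      Finset.inter_subset_right
  simp [opZ, sigmaZ, monomialOp_apply, h, pow_add, mul_assoc]

/-- The algebra of all operators on the qubits in the finite set `Λ`. -/
def localAlgebra (Λ : Finset Edge) : StarSubalgebra ℂ (Hilb →L[ℂ] Hilb) :=
  StarAlgebra.adjoin ℂ (sigmaX '' (Λ : Set Edge) ∪ sigmaZ '' (Λ : Set Edge))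

/-- The C*-algebra of quasi-local operators: the norm closure of the local ones. -/
def quasiLocalAlgebra : StarSubalgebra ℂ (Hilb →L[ℂ] Hilb) :=
  (⨆ Λ : Finset Edge, localAlgebra Λ).topologicalClosure

/-- The C*-algebra of quasi-local operators, as a type. -/
abbrev Obs : Type := quasiLocalAlgebra

/-- Local observables: those acting on finitely many qubits. -/
def IsLocal (O : Obs) : Prop := ∃ Λ : Finset Edge, (O : Hilb →L[ℂ] Hilb) ∈ localAlgebra Λ

theorem localAlgebra_le (Λ : Finset Edge) : localAlgebra Λ ≤ quasiLocalAlgebra :=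
  (le_iSup localAlgebra Λ).trans (StarSubalgebra.le_topologicalClosure _)

theorem localAlgebra_mono {Λ Λ' : Finset Edge} (h : Λ ⊆ Λ') :
    localAlgebra Λ ≤ localAlgebra Λ' := by
  have h' : (Λ : Set Edge) ⊆ Λ' := by exact_mod_cast h
  exact StarAlgebra.adjoin_le ((Set.union_subset_union (Set.image_mono h')
    (Set.image_mono h')).trans (StarAlgebra.subset_adjoin ℂ _))

theorem opX_mem_localAlgebra (T : Finset Edge) : opX T ∈ localAlgebra T := by
  induction T using Finset.induction_on with
  | empty => rw [opX_empty]; exact one_mem _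
  | insert e T he ih =>
    rw [opX_insert he]
    refine mul_mem (StarAlgebra.subset_adjoin ℂ _ (Or.inl ⟨e, by simp, rfl⟩)) ?_
    exact localAlgebra_mono (Finset.subset_insert e T) ih

theorem opZ_mem_localAlgebra (T : Finset Edge) : opZ T ∈ localAlgebra T := by
  induction T using Finset.induction_on with
  | empty => rw [opZ_empty]; exact one_mem _
  | insert e T he ih =>
    rw [opZ_insert he]
    refine mul_mem (StarAlgebra.subset_adjoin ℂ _ (Or.inr ⟨e, by simp, rfl⟩)) ?_
    exact localAlgebra_mono (Finset.subset_insert e T) ih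

/-- The observable `∏_{e ∈ T} σˣ_e`. -/
def obsX (T : Finset Edge) : Obs := ⟨opX T, localAlgebra_le T (opX_mem_localAlgebra T)⟩

/-- The observable `∏_{e ∈ T} σᶻ_e`. -/
def obsZ (T : Finset Edge) : Obs := ⟨opZ T, localAlgebra_le T (opZ_mem_localAlgebra T)⟩

/-! ### The toric code -/

/-- The star operator `A_v`. -/
def starOp (v : Vertex) : Obs := obsX (starEdges v)

/-- The plaquette operator `B_f`. -/
def plaquetteOp (f : Face) : Obs := obsZ (faceEdges f)

/-- The vertices all of whose edges lie in `Λ`. -/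
def regionVertices (Λ : Finset Edge) : Finset Vertex :=
  (Λ.image Prod.fst).filter (fun v => starEdges v ⊆ Λ)

/-- The faces all of whose edges lie in `Λ`. -/
def regionFaces (Λ : Finset Edge) : Finset Face :=
  ((Λ.image Prod.fst) ×ˢ Finset.univ).filter (fun f => faceEdges f ⊆ Λ)

theorem mem_regionVertices {Λ : Finset Edge} {v : Vertex} :
    v ∈ regionVertices Λ ↔ starEdges v ⊆ Λ := by
  simp only [regionVertices, Finset.mem_filter, and_iff_right_iff_imp]
  intro h
  exact Finset.mem_image.2 ⟨(v, 0), h (by simp [starEdges]), rfl⟩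

theorem mem_regionFaces {Λ : Finset Edge} {f : Face} :
    f ∈ regionFaces Λ ↔ faceEdges f ⊆ Λ := by
  simp only [regionFaces, Finset.mem_filter, Finset.mem_product, Finset.mem_univ, and_true,
    and_iff_right_iff_imp]
  intro h
  exact Finset.mem_image.2 ⟨(f.1, f.2 + 1), h (by simp [faceEdges]), rfl⟩

/-- The Hamiltonian of the finite region `Λ`. -/
def hamiltonian (Λ : Finset Edge) : Obs :=
  ∑ v ∈ regionVertices Λ, (1 - starOp v) + ∑ f ∈ regionFaces Λ, (1 - plaquetteOp f)

/-- The graph of the derivation `δ(O) = lim_Λ i [H_Λ, O]` on local observables. -/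
def localDerivationGraph : Set (Obs × Obs) :=
  {x | IsLocal x.1 ∧
    Tendsto (fun Λ : Finset Edge => Complex.I • (hamiltonian Λ * x.1 - x.1 * hamiltonian Λ))
      atTop (𝓝 x.2)}

/-- The graph of the unbounded derivation `δ` generating the dynamics, which is the closure of
the derivation on local observables: `(O, D)` belongs to it if `O` is in the domain of `δ` and
`δ(O) = D`. -/
def derivationGraph : Set (Obs × Obs) := closure localDerivationGraph

/-- States: normalized positive linear functionals (`0 ≤ z` means that `z` is real and
nonnegative). -/
def IsState (ω : Obs →ₗ[ℂ] ℂ) : Prop := (∀ O : Obs, 0 ≤ ω (star O * O)) ∧ ω 1 = 1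

/-- Ground states: `-i ω(O* δ(O)) ≥ 0` for all `O` in the domain of `δ`. -/
def IsGroundState (ω : Obs →ₗ[ℂ] ℂ) : Prop :=
  IsState ω ∧ ∀ O D : Obs, (O, D) ∈ derivationGraph → 0 ≤ -Complex.I * ω (star O * D)

/-- The vacuum: a state with `ω(A_v) = ω(B_f) = 1` for all vertices `v` and faces `f`. -/
def IsVacuum (ω : Obs →ₗ[ℂ] ℂ) : Prop :=
  IsState ω ∧ (∀ v : Vertex, ω (starOp v) = 1) ∧ ∀ f : Face, ω (plaquetteOp f) = 1

/-- The flux string operator `F_S` of a finite surface `S` in the dual lattice: the product of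
`σˣ_e` over all edges `e` dual to a face in `S`. -/
def fluxOp (S : Finset Face) : Obs := obsX (S.image edgeOfDualFace)

/-- `α(O) = lim_n F_{S n} O F_{S n}` in norm, for all observables `O`. -/
def IsFluxAutomorphism (S : ℕ → Finset Face) (α : Obs ≃⋆ₐ[ℂ] Obs) : Prop :=
  ∀ O : Obs, Tendsto (fun n => fluxOp (S n) * O * fluxOp (S n)) atTop (𝓝 (α O))

/-- The state `ω ∘ α`. -/
def pullback (ω : Obs →ₗ[ℂ] ℂ) (α : Obs ≃⋆ₐ[ℂ] Obs) : Obs →ₗ[ℂ] ℂ :=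
  ω ∘ₗ α.toAlgEquiv.toLinearMap

end

end ToricCode3D

namespace ToricCode3D

/-! ### Pauli operators -/

/-! The whole argument runs on the signs that `α` produces. Conjugation by `F_S` fixes every `A_v`
and multiplies `B_f` by the parity with which the dual edge of `f` occurs in `∂S`. So `φ = ω ∘ α`
has `φ(A_v) = 1`, while `φ(B_f)` is `-1` exactly on the faces crossed by the string (`IsFluxState`).
By Cauchy–Schwarz such extremal values can be pulled out on the right: `φ(X B_f) = ± φ(X)`.

If the path is monotonic, it crosses each plane of parallel faces at most once. The product of `B_f`
over a large piece of a plane is supported on the rim of that piece, hence commutes with a given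
local `O`: the flux parity of the plane is conserved. Commuting involutions satisfy `1 - ∏ B_f ≤ ∑
(1 - B_f)`, and in `φ` the two sides agree because at most one sign is negative. So `O` cannot lower
the energy of any plane (`face_energy_nonneg`), and the star terms are already at their minimum.

If the path is not monotonic, it contains two opposite steps along one axis with only perpendicular
steps between them. Translating the section between them by one unit cancels both steps
(`exists_shortening`). The local operator that does this commutes with all `A_v` and strictly lowers
the energy, which violates the ground state inequality (`IsFluxState.isMonotonic`).

Existence of `α` rests on locality, existence of `ω` on compactness, and existence of a bounding
sequence on the fact that a locally finite mod 2 cycle in `ℤ³` is a boundary. -/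

theorem monomialOp_star {p : Equiv.Perm (Finset Edge)} {c : Finset Edge → ℤˣ}
    (hp : ∀ s, p (p s) = s) (hc : ∀ s, c (p s) = c s) :
    star (monomialOp p c) = monomialOp p c := by
  rw [ContinuousLinearMap.star_eq_adjoint]
  symm
  rw [ContinuousLinearMap.eq_adjoint_iff]
  intro f g
  rw [lp.inner_eq_tsum, lp.inner_eq_tsum, ← p.tsum_eq]
  refine tsum_congr fun s => ?_
  rw [monomialOp_apply, monomialOp_apply, hp, hc]
  simp only [RCLike.inner_apply, map_mul, map_intCast]
  ring

theorem opX_apply (T : Finset Edge) (f : Hilb) (s : Finset Edge) :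
    opX T f s = f (symmDiff s T) := by
  simp [opX, monomialOp_apply, flipPerm]

theorem opZ_apply (U : Finset Edge) (f : Hilb) (s : Finset Edge) :
    opZ U f s = (-1) ^ (s ∩ U).card * f s := by
  simp [opZ, monomialOp_apply]

theorem opX_star (T : Finset Edge) : star (opX T) = opX T :=
  monomialOp_star (fun s => symmDiff_symmDiff_cancel_right T s) fun _ => rfl

theorem opZ_star (U : Finset Edge) : star (opZ U) = opZ U :=
  monomialOp_star (fun _ => rfl) fun _ => rfl

theorem opX_mul (T T' : Finset Edge) : opX T * opX T' = opX (symmDiff T T') := by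
  ext f s
  simp [opX_apply, symmDiff_assoc]

theorem neg_one_pow_card_symmDiff (s t : Finset Edge) :
    (-1 : ℂ) ^ (symmDiff s t).card = (-1) ^ s.card * (-1) ^ t.card := by
  have h1 : (symmDiff s t).card = (s \ t).card + (t \ s).card := by
    rw [symmDiff_def, Finset.sup_eq_union, Finset.card_union_of_disjoint disjoint_sdiff_sdiff]
  rw [h1, ← Finset.card_sdiff_add_card_inter s t, ← Finset.card_sdiff_add_card_inter t s,
    Finset.inter_comm t s, pow_add, pow_add, pow_add]
  have h2 : ((-1 : ℂ) ^ (s ∩ t).card) * (-1) ^ (s ∩ t).card = 1 := by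
    rw [← mul_pow]; simp
  linear_combination (-(-1 : ℂ) ^ (s \ t).card * (-1) ^ (t \ s).card) * h2

theorem opZ_mul (U U' : Finset Edge) : opZ U * opZ U' = opZ (symmDiff U U') := by
  ext f s
  have h : s ∩ symmDiff U U' = symmDiff (s ∩ U) (s ∩ U') := inf_symmDiff_distrib_left s U U'
  simp [opZ_apply, h, neg_one_pow_card_symmDiff, mul_assoc]

theorem opX_mul_opZ (T U : Finset Edge) :
    opX T * opZ U = ((-1 : ℂ) ^ (T ∩ U).card) • (opZ U * opX T) := by
  ext f s
  have h : symmDiff s T ∩ U = symmDiff (s ∩ U) (T ∩ U) := inf_symmDiff_distrib_right s T U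
  simp [opZ_apply, opX_apply, h, neg_one_pow_card_symmDiff]
  ring

theorem obsX_star (T : Finset Edge) : star (obsX T) = obsX T := Subtype.ext (opX_star T)

theorem obsZ_star (U : Finset Edge) : star (obsZ U) = obsZ U := Subtype.ext (opZ_star U)

theorem obsX_mul (T T' : Finset Edge) : obsX T * obsX T' = obsX (symmDiff T T') :=
  Subtype.ext (opX_mul T T')

theorem obsZ_mul (U U' : Finset Edge) : obsZ U * obsZ U' = obsZ (symmDiff U U') :=
  Subtype.ext (opZ_mul U U')

theorem obsX_empty : obsX ∅ = 1 := Subtype.ext opX_empty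

theorem obsZ_empty : obsZ ∅ = 1 := Subtype.ext opZ_empty

theorem obsX_mul_self (T : Finset Edge) : obsX T * obsX T = 1 := by
  rw [obsX_mul, symmDiff_self]; exact obsX_empty

theorem obsZ_mul_self (U : Finset Edge) : obsZ U * obsZ U = 1 := by
  rw [obsZ_mul, symmDiff_self]; exact obsZ_empty

theorem obsX_comm (T T' : Finset Edge) : Commute (obsX T) (obsX T') := by
  rw [commute_iff_eq, obsX_mul, obsX_mul, symmDiff_comm]

theorem obsZ_comm (U U' : Finset Edge) : Commute (obsZ U) (obsZ U') := by
  rw [commute_iff_eq, obsZ_mul, obsZ_mul, symmDiff_comm]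

theorem obsX_mul_obsZ (T U : Finset Edge) :
    obsX T * obsZ U = ((-1 : ℂ) ^ (T ∩ U).card) • (obsZ U * obsX T) :=
  Subtype.ext (opX_mul_opZ T U)

theorem obsX_comm_obsZ {T U : Finset Edge} (h : Even (T ∩ U).card) :
    Commute (obsX T) (obsZ U) := by
  rw [commute_iff_eq, obsX_mul_obsZ, h.neg_one_pow, one_smul]

theorem obsX_conj_obsZ (T U : Finset Edge) :
    obsX T * obsZ U * obsX T = ((-1 : ℂ) ^ (T ∩ U).card) • obsZ U := by
  rw [obsX_mul_obsZ, smul_mul_assoc, mul_assoc, obsX_mul_self, mul_one]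

/-! ### Locality -/

/-- The centralizer of a self-adjoint operator is a star subalgebra, so commutation need only be
tested on the generating Pauli matrices. -/
theorem commute_of_mem_localAlgebra {Λ : Finset Edge} {X O : Hilb →L[ℂ] Hilb}
    (hX : star X = X) (hx : ∀ e ∈ Λ, Commute X (sigmaX e)) (hz : ∀ e ∈ Λ, Commute X (sigmaZ e))
    (hO : O ∈ localAlgebra Λ) : Commute X O := by
  have h : localAlgebra Λ ≤ StarSubalgebra.centralizer ℂ {X} := by
    refine StarAlgebra.adjoin_le ?_
    rintro _ (⟨e, he, rfl⟩ | ⟨e, he, rfl⟩) <;>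
      rw [SetLike.mem_coe, StarSubalgebra.mem_centralizer_iff] <;>
      rintro _ rfl <;> rw [hX]
    · exact ⟨hx e he, hx e he⟩
    · exact ⟨hz e he, hz e he⟩
  exact ((StarSubalgebra.mem_centralizer_iff ℂ).1 (h hO) X rfl).1

theorem obsX_comm_of_disjoint {Λ T : Finset Edge} {O : Obs}
    (hO : (O : Hilb →L[ℂ] Hilb) ∈ localAlgebra Λ) (h : Disjoint T Λ) : Commute (obsX T) O := by
  refine Subtype.ext (commute_of_mem_localAlgebra (opX_star T) (fun e _ => ?_) (fun e he => ?_) hO)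
  · exact congrArg Subtype.val (obsX_comm T {e})
  · refine congrArg Subtype.val (obsX_comm_obsZ (T := T) (U := {e}) ?_)
    rw [Finset.disjoint_iff_inter_eq_empty.1 (h.mono_right (Finset.singleton_subset_iff.2 he))]
    simp

theorem obsZ_comm_of_disjoint {Λ U : Finset Edge} {O : Obs}
    (hO : (O : Hilb →L[ℂ] Hilb) ∈ localAlgebra Λ) (h : Disjoint U Λ) : Commute (obsZ U) O := by
  refine Subtype.ext (commute_of_mem_localAlgebra (opZ_star U) (fun e he => ?_) (fun e _ => ?_) hO)
  · refine congrArg Subtype.val (obsX_comm_obsZ (T := {e}) (U := U) ?_).symm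
    rw [Finset.inter_comm,
      Finset.disjoint_iff_inter_eq_empty.1 (h.mono_right (Finset.singleton_subset_iff.2 he))]
    simp
  · exact congrArg Subtype.val (obsZ_comm U {e})

theorem isLocal_obsX (T : Finset Edge) : IsLocal (obsX T) := ⟨T, opX_mem_localAlgebra T⟩

theorem dense_isLocal : Dense {O : Obs | IsLocal O} := by
  have hd : Directed (· ≤ ·) localAlgebra := fun Λ Λ' =>
    ⟨Λ ∪ Λ', localAlgebra_mono Finset.subset_union_left, localAlgebra_mono Finset.subset_union_right⟩
  intro O
  rw [closure_subtype]
  have h : (O : Hilb →L[ℂ] Hilb) ∈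
      closure ((⨆ Λ : Finset Edge, localAlgebra Λ : StarSubalgebra ℂ _) : Set _) := O.2
  refine closure_mono ?_ h
  rw [StarSubalgebra.coe_iSup_of_directed hd]
  rintro x ⟨_, ⟨Λ, rfl⟩, hx⟩
  exact ⟨⟨x, localAlgebra_le Λ hx⟩, ⟨Λ, hx⟩, rfl⟩

theorem isClosed_quasiLocalAlgebra : IsClosed (quasiLocalAlgebra : Set (Hilb →L[ℂ] Hilb)) :=
  StarSubalgebra.isClosed_topologicalClosure _

/-! ### States -/

/-- In the spectral order the positive elements are generated by the `star a * a`, so `φ` is a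
positive map, and positive functionals on a C*-algebra are automatically continuous. -/
theorem continuous_of_star_mul_self_nonneg {A : Type*} [CStarAlgebra A] {φ : A →ₗ[ℂ] ℂ}
    (hφ : ∀ a : A, 0 ≤ φ (star a * a)) : Continuous φ := by
  let _ := CStarAlgebra.spectralOrder A
  have _ := CStarAlgebra.spectralOrderedRing A
  have h : ∀ x : A, 0 ≤ x → 0 ≤ φ x := by
    intro x hx
    rw [StarOrderedRing.nonneg_iff] at hx
    induction hx using AddSubmonoid.closure_induction with
    | mem x hx => obtain ⟨y, rfl⟩ := hx; exact hφ y
    | zero => simp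
    | add x y _ _ hx hy => rw [map_add]; exact add_nonneg hx hy
  let f : A →ₚ[ℂ] ℂ := PositiveLinearMap.mk₀ φ h
  exact map_continuous f

theorem IsState.continuous {φ : Obs →ₗ[ℂ] ℂ} (hφ : IsState φ) : Continuous φ :=
  have := isClosed_quasiLocalAlgebra
  continuous_of_star_mul_self_nonneg (A := quasiLocalAlgebra) hφ.1

/-- The semi-inner product `⟪X, Y⟫ = φ (X* Y)` of a state. -/
@[reducible]
noncomputable def IsState.innerCore {φ : Obs →ₗ[ℂ] ℂ} (hφ : IsState φ) :
    PreInnerProductSpace.Core ℂ Obs where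
  inner X Y := φ (star X * Y)
  -- Polarization: `φ (star Z * Z)` is real for `Z = X + Y` and `Z = X + iY`, which gives the
  -- imaginary and the real part of the symmetry.
  conj_inner_symm X Y := by
    have h : ∀ Z : Obs, (φ (star Z * Z)).im = 0 := fun Z => (Complex.nonneg_iff.1 (hφ.1 Z)).2.symm
    have h1 := h (X + Y)
    have h2 := h (X + Complex.I • Y)
    simp only [star_add, star_smul, add_mul, mul_add, map_add, Complex.add_im, h, smul_mul_assoc,
      mul_smul_comm, map_smul, smul_eq_mul, Complex.mul_im, Complex.mul_re, Complex.I_re, Complex.I_im,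
      Complex.star_def, Complex.conj_I, Complex.neg_re, Complex.neg_im] at h1 h2
    apply Complex.ext
    · simp only [Complex.conj_re]; linarith
    · simp only [Complex.conj_im]; linarith
  re_inner_nonneg X := (Complex.nonneg_iff.1 (hφ.1 X)).1
  add_left X Y Z := by simp [add_mul]
  smul_left X Y r := by simp

/-- Cauchy–Schwarz for the semi-inner product of the state. -/
theorem IsState.map_mul_eq_zero {φ : Obs →ₗ[ℂ] ℂ} (hφ : IsState φ) {N : Obs}
    (hN : φ (star N * N) = 0) (X : Obs) : φ (X * N) = 0 := by
  let _ := hφ.innerCore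
  let _ := hφ.innerCore.toInner
  have h := InnerProductSpace.Core.inner_mul_inner_self_le (𝕜 := ℂ) (star X) N
  have h1 : inner ℂ (star X) N = φ (X * N) := by
    change φ (star (star X) * N) = _
    rw [star_star]
  have h2 : inner ℂ N (star X) = (starRingEnd ℂ) (φ (X * N)) := by
    rw [← h1]; exact (hφ.innerCore.conj_inner_symm N (star X)).symm
  have h3 : inner ℂ N N = (0 : ℂ) := hN
  rw [h1, h2, h3, RCLike.norm_conj] at h
  simp only [map_zero, mul_zero] at h
  exact norm_eq_zero.1 (mul_self_eq_zero.1 (le_antisymm h (mul_self_nonneg _)))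

/-- With `N = B - b` one gets `φ(N* N) = 1 - 2b² + b² = 0`, so `N` is a null vector and `φ(X N) =
0`. -/
theorem IsState.map_mul_of_eigen {φ : Obs →ₗ[ℂ] ℂ} (hφ : IsState φ) {B : Obs} (hs : star B = B)
    (hB : B * B = 1) {b : ℤ} (hb : b * b = 1) (h : φ B = b) (X : Obs) : φ (X * B) = b * φ X := by
  have hb' : (b : ℂ) * b = 1 := by exact_mod_cast hb
  have h0 : φ (star (B - (b : ℂ) • 1) * (B - (b : ℂ) • 1)) = 0 := by
    have : star (B - (b : ℂ) • 1) = B - (b : ℂ) • 1 := by simp [hs]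
    rw [this]
    simp only [mul_sub, sub_mul, hB, map_sub, smul_mul_assoc, mul_smul_comm, one_mul, mul_one,
      map_smul, h, hφ.2, smul_eq_mul]
    linear_combination -hb'
  have h1 := hφ.map_mul_eq_zero h0 X
  rw [mul_sub, map_sub, mul_smul_comm, mul_one, map_smul, smul_eq_mul] at h1
  linear_combination h1

/-! ### Incidence relations -/

theorem unit_ne_zero (i : Fin 3) : unit i ≠ 0 := fun h => by
  have := congrFun h i
  simp [unit] at this

theorem sum_faceEdges {M : Type*} [AddCommMonoid M] (f : Face) (g : Edge → M) :
    ∑ e ∈ faceEdges f, g e = g (f.1, f.2 + 1) + (g (f.1, f.2 + 2) +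
      (g (f.1 + unit (f.2 + 1), f.2 + 2) + g (f.1 + unit (f.2 + 2), f.2 + 1))) := by
  obtain ⟨v, k⟩ := f
  have h12 : k + 1 ≠ k + 2 := by revert k; decide
  have h1 := unit_ne_zero (k + 1)
  have h2 := unit_ne_zero (k + 2)
  rw [faceEdges, Finset.sum_insert, Finset.sum_insert, Finset.sum_insert, Finset.sum_singleton] <;>
    simp [h12, h12.symm, h1, h2]

theorem sum_starEdges {M : Type*} [AddCommMonoid M] (v : Vertex) (g : Edge → M) :
    ∑ e ∈ starEdges v, g e = ∑ i : Fin 3, (g (v, i) + g (v - unit i, i)) := by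
  rw [starEdges, Finset.sum_union, Finset.sum_image, Finset.sum_image, Finset.sum_add_distrib]
  · intro i _ j _ h
    exact (Prod.ext_iff.1 h).2
  · intro i _ j _ h
    exact (Prod.ext_iff.1 h).2
  · rw [Finset.disjoint_left]
    intro e h1 h2
    simp only [Finset.mem_image, Finset.mem_univ, true_and] at h1 h2
    obtain ⟨i, rfl⟩ := h1
    obtain ⟨j, h⟩ := h2
    simp only [Prod.mk.injEq, sub_eq_self] at h
    exact unit_ne_zero j h.1

theorem mem_starEdges {v : Vertex} {e : Edge} :
    e ∈ starEdges v ↔ e.1 = v ∨ e.1 + unit e.2 = v := by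
  obtain ⟨w, i⟩ := e
  simp only [starEdges, Finset.mem_union, Finset.mem_image, Finset.mem_univ, true_and,
    Prod.mk.injEq]
  constructor
  · rintro (⟨j, rfl, rfl⟩ | ⟨j, rfl, rfl⟩) <;> simp
  · rintro (rfl | rfl)
    · exact Or.inl ⟨i, rfl, rfl⟩
    · exact Or.inr ⟨i, by simp, rfl⟩

/-- Modulo 2, membership of an edge in the star of `v` counts those of its endpoints equal to `v`;
around a face every corner is counted twice. -/
theorem even_card_star_inter_face (v : Vertex) (f : Face) :
    Even (starEdges v ∩ faceEdges f).card := by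
  have h : ∀ e : Edge, (if e ∈ starEdges v then (1 : ZMod 2) else 0) =
      (if e.1 = v then 1 else 0) + (if e.1 + unit e.2 = v then 1 else 0) := by
    intro e
    have h0 : e.1 = v → e.1 + unit e.2 ≠ v := by
      rintro rfl h; exact unit_ne_zero e.2 (add_eq_left.1 h)
    simp only [mem_starEdges]
    by_cases h1 : e.1 = v <;> by_cases h2 : e.1 + unit e.2 = v <;> simp_all
  rw [← ZMod.natCast_eq_zero_iff_even, Finset.inter_comm, ← Finset.filter_mem_eq_inter,
    Finset.natCast_card_filter, sum_faceEdges]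
  simp only [h]
  rw [add_right_comm f.1 (unit (f.2 + 2))]
  generalize (if f.1 = v then (1 : ZMod 2) else 0) = a
  generalize (if f.1 + unit (f.2 + 1) = v then (1 : ZMod 2) else 0) = b
  generalize (if f.1 + unit (f.2 + 2) = v then (1 : ZMod 2) else 0) = c
  generalize (if f.1 + unit (f.2 + 1) + unit (f.2 + 2) = v then (1 : ZMod 2) else 0) = d
  revert a b c d
  decide

theorem starOp_comm_plaquetteOp (v : Vertex) (f : Face) : Commute (starOp v) (plaquetteOp f) :=
  obsX_comm_obsZ (even_card_star_inter_face v f)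

/-! ### Existence of the vacuum -/

/-- Start from the all-up configuration, which every `B_f` fixes, and apply `1 + A_v` one vertex at
a time. Nonnegative coefficients rule out cancellation, so the coefficient at `∅` stays positive and
the vector nonzero. -/
theorem exists_stabilized_vector (V : Finset Vertex) :
    ∃ ψ : Hilb, (∀ s, 0 ≤ ψ s) ∧ 0 < ψ ∅ ∧ (∀ v ∈ V, opX (starEdges v) ψ = ψ) ∧
      ∀ f, opZ (faceEdges f) ψ = ψ := by
  induction V using Finset.induction_on with
  | empty =>
    refine ⟨lp.single 2 ∅ 1, fun s => ?_, ?_, by simp, fun f => ?_⟩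
    · by_cases h : s = ∅
      · subst h; simp
      · simp [h]
    · simp
    · ext s
      rw [opZ_apply]
      by_cases h : s = ∅
      · subst h; simp
      · simp [h]
  | insert v V _ ih =>
    obtain ⟨ψ, h0, h1, h2, h3⟩ := ih
    refine ⟨ψ + opX (starEdges v) ψ, fun s => ?_, ?_, fun w hw => ?_, fun f => ?_⟩
    · rw [lp.coeFn_add, Pi.add_apply, opX_apply]
      exact add_nonneg (h0 _) (h0 _)
    · rw [lp.coeFn_add, Pi.add_apply, opX_apply]
      exact add_pos_of_pos_of_nonneg h1 (h0 _)
    · have hc : opX (starEdges w) (opX (starEdges v) ψ) = opX (starEdges v) (opX (starEdges w) ψ) :=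
        congrArg (fun O : Obs => (O : Hilb →L[ℂ] Hilb) ψ) (obsX_comm (starEdges w) (starEdges v))
      rw [map_add]
      rcases Finset.mem_insert.1 hw with rfl | hw
      · have hs : opX (starEdges w) (opX (starEdges w) ψ) = ψ :=
          congrArg (fun O : Obs => (O : Hilb →L[ℂ] Hilb) ψ) (obsX_mul_self (starEdges w))
        rw [hs, add_comm]
      · rw [hc, h2 w hw]
    · have hc : opZ (faceEdges f) (opX (starEdges v) ψ) = opX (starEdges v) (opZ (faceEdges f) ψ) :=
        congrArg (fun O : Obs => (O : Hilb →L[ℂ] Hilb) ψ) (starOp_comm_plaquetteOp v f).symm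
      rw [map_add, hc, h3]

theorem exists_stabilized_unit_vector (V : Finset Vertex) :
    ∃ ψ : Hilb, ‖ψ‖ = 1 ∧ (∀ v ∈ V, opX (starEdges v) ψ = ψ) ∧
      ∀ f, opZ (faceEdges f) ψ = ψ := by
  obtain ⟨ψ, -, h1, h2, h3⟩ := exists_stabilized_vector V
  have hψ : ψ ≠ 0 := by
    rintro rfl
    simp at h1
  refine ⟨((‖ψ‖⁻¹ : ℝ) : ℂ) • ψ, ?_, fun v hv => ?_, fun f => ?_⟩
  · rw [norm_smul, Complex.norm_real, norm_inv, norm_norm, inv_mul_cancel₀ (norm_ne_zero_iff.2 hψ)]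
  · rw [map_smul, h2 v hv]
  · rw [map_smul, h3]

theorem exists_vacuum : ∃ ω : Obs →ₗ[ℂ] ℂ, IsVacuum ω := by
  choose ψ hψ hA hB using exists_stabilized_unit_vector
  -- Expectation values are bounded by `‖O‖`, so they converge along any ultrafilter; one finer than
  -- `atTop` keeps each condition `A_v = 1`, which holds for all large `V`.
  let u : Ultrafilter (Finset Vertex) := Ultrafilter.of atTop
  let F : Finset Vertex → Obs → ℂ := fun V O => inner ℂ (ψ V) ((O : Hilb →L[ℂ] Hilb) (ψ V))
  have hF : ∀ O : Obs, ∃ z, Tendsto (fun V => F V O) u (𝓝 z) := by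
    intro O
    have hb : ∀ V, F V O ∈ Metric.closedBall (0 : ℂ) ‖O‖ := by
      intro V
      rw [mem_closedBall_zero_iff]
      refine (norm_inner_le_norm _ _).trans ?_
      rw [hψ, one_mul]
      refine ((O : Hilb →L[ℂ] Hilb).le_opNorm _).trans ?_
      rw [hψ, mul_one]
      rfl
    obtain ⟨z, -, hz⟩ := (isCompact_closedBall (0 : ℂ) ‖O‖).ultrafilter_le_nhds
      (u.map fun V => F V O) (by
        rw [le_principal_iff]
        exact Filter.mem_map.2 (Eventually.of_forall hb))
    exact ⟨z, hz⟩
  choose z hz using hF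
  have huniq : ∀ O w, (∀ᶠ V in atTop, F V O = w) → z O = w := fun O w h =>
    tendsto_nhds_unique (hz O)
      (tendsto_const_nhds.congr' ((h.filter_mono (Ultrafilter.of_le atTop)).mono fun _ h => h.symm))
  have h1 : ∀ V, F V 1 = 1 := by
    intro V
    change inner ℂ (ψ V) (ψ V) = _
    rw [inner_self_eq_norm_sq_to_K, hψ]
    simp
  refine ⟨{ toFun := z, map_add' := fun X Y => ?_, map_smul' := fun c X => ?_ },
    ⟨fun O => ?_, ?_⟩, fun v => ?_, fun f => ?_⟩
  · refine tendsto_nhds_unique (hz (X + Y)) (((hz X).add (hz Y)).congr fun V => ?_)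
    simp only [F, ← inner_add_right]
    rfl
  · refine tendsto_nhds_unique (hz (c • X)) (((hz X).const_mul c).congr fun V => ?_)
    simp only [F, ← inner_smul_right]
    rfl
  · refine ge_of_tendsto' (hz (star O * O)) fun V => ?_
    have : F V (star O * O) = inner ℂ ((O : Hilb →L[ℂ] Hilb) (ψ V)) ((O : Hilb →L[ℂ] Hilb) (ψ V)) := by
      change inner ℂ (ψ V) ((star (O : Hilb →L[ℂ] Hilb)) ((O : Hilb →L[ℂ] Hilb) (ψ V))) = _
      rw [ContinuousLinearMap.star_eq_adjoint, ContinuousLinearMap.adjoint_inner_right]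
    rw [this, inner_self_eq_norm_sq_to_K]
    simp only [Complex.coe_algebraMap]
    exact_mod_cast sq_nonneg (‖(O : Hilb →L[ℂ] Hilb) (ψ V)‖)
  · exact huniq 1 1 (Eventually.of_forall h1)
  · refine huniq _ 1 ((eventually_ge_atTop {v}).mono fun V hV => ?_)
    have h2 := hA V v (Finset.singleton_subset_iff.1 hV)
    rw [← h1 V]
    exact congrArg (inner ℂ (ψ V)) h2
  · refine huniq _ 1 (Eventually.of_forall fun V => ?_)
    rw [← h1 V]
    exact congrArg (inner ℂ (ψ V)) (hB V f)

/-! ### The flux automorphism -/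

/-- The flips outside `Λ` commute with `O` and square to `1`. Hence conjugation of a local
observable depends only on `T ∩ Λ`, which is eventually constant along an increasing sequence. -/
theorem obsX_conj_eq {Λ T : Finset Edge} {O : Obs}
    (hO : (O : Hilb →L[ℂ] Hilb) ∈ localAlgebra Λ) :
    obsX T * O * obsX T = obsX (T ∩ Λ) * O * obsX (T ∩ Λ) := by
  have h : obsX T = obsX (T ∩ Λ) * obsX (T \ Λ) := by
    rw [obsX_mul]
    congr 1
    rw [(Finset.disjoint_of_subset_left Finset.inter_subset_right
      Finset.disjoint_sdiff).symmDiff_eq_sup, Finset.sup_eq_union, Finset.union_comm,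
      Finset.sdiff_union_inter]
  have hc := obsX_comm_of_disjoint hO (Finset.sdiff_disjoint : Disjoint (T \ Λ) Λ)
  rw [h]
  nth_rewrite 2 [(obsX_comm (T ∩ Λ) (T \ Λ)).eq]
  calc _ = obsX (T ∩ Λ) * (obsX (T \ Λ) * O) * obsX (T \ Λ) * obsX (T ∩ Λ) := by
        simp only [mul_assoc]
    _ = obsX (T ∩ Λ) * O * (obsX (T \ Λ) * obsX (T \ Λ)) * obsX (T ∩ Λ) := by
        rw [hc.eq]; simp only [mul_assoc]
    _ = _ := by rw [obsX_mul_self, mul_one]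

theorem eventually_inter_eq {T : ℕ → Finset Edge} (hT : Monotone T) (Λ : Finset Edge) :
    ∃ T' : Finset Edge, ∀ᶠ n in atTop, T n ∩ Λ = T' := by
  classical
  refine ⟨Λ.filter fun e => ∃ m, e ∈ T m, ?_⟩
  have h : ∀ e ∈ Λ, ∀ᶠ n in atTop, (e ∈ T n ↔ ∃ m, e ∈ T m) := by
    intro e _
    by_cases he : ∃ m, e ∈ T m
    · obtain ⟨m, hm⟩ := he
      exact (eventually_ge_atTop m).mono fun n hn => ⟨fun h => ⟨n, h⟩, fun _ => hT hn hm⟩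
    · exact Eventually.of_forall fun n => ⟨fun h => ⟨n, h⟩, fun h => absurd h he⟩
  filter_upwards [(Filter.eventually_all_finset Λ).2 h] with n hn
  ext e
  simp only [Finset.mem_inter, Finset.mem_filter]
  constructor
  · rintro ⟨h1, h2⟩; exact ⟨h2, (hn e h2).1 h1⟩
  · rintro ⟨h1, h2⟩; exact ⟨(hn e h1).2 h2, h1⟩

theorem norm_obsX_le (T : Finset Edge) : ‖obsX T‖ ≤ 1 := by
  have h := CStarRing.norm_star_mul_self (x := obsX T)
  rw [obsX_star, obsX_mul_self] at h
  have h1 : ‖(1 : Obs)‖ ≤ 1 := ContinuousLinearMap.norm_id_le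
  nlinarith [norm_nonneg (obsX T)]

theorem norm_obsX_conj_le (T : Finset Edge) (O : Obs) : ‖obsX T * O * obsX T‖ ≤ ‖O‖ := by
  have h := norm_obsX_le T
  calc ‖obsX T * O * obsX T‖ ≤ ‖obsX T‖ * ‖O‖ * ‖obsX T‖ :=
        (norm_mul_le _ _).trans (by gcongr; exact norm_mul_le _ _)
    _ ≤ 1 * ‖O‖ * 1 := by gcongr
    _ = ‖O‖ := by ring

theorem exists_tendsto_obsX_conj {T : ℕ → Finset Edge} (hT : Monotone T) (O : Obs) :
    ∃ D, Tendsto (fun n => obsX (T n) * O * obsX (T n)) atTop (𝓝 D) := by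
  have : CompleteSpace Obs := isClosed_quasiLocalAlgebra.completeSpace_coe
  apply cauchySeq_tendsto_of_complete
  rw [Metric.cauchySeq_iff']
  intro ε hε
  obtain ⟨O', ⟨Λ, hO'⟩, hd⟩ := dense_isLocal.exists_dist_lt O (half_pos hε)
  obtain ⟨T', hT'⟩ := eventually_inter_eq hT Λ
  obtain ⟨N, hN⟩ := eventually_atTop.1 hT'
  have key : ∀ n ≥ N, ‖obsX (T n) * O * obsX (T n) - obsX T' * O' * obsX T'‖ < ε / 2 := by
    intro n hn
    rw [← hN n hn, ← obsX_conj_eq hO', ← sub_mul, ← mul_sub]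
    rw [dist_eq_norm] at hd
    exact (norm_obsX_conj_le _ _).trans_lt hd
  refine ⟨N, fun n hn => ?_⟩
  have h1 := key n hn
  have h2 := key N le_rfl
  rw [← dist_eq_norm] at h1 h2
  rw [dist_comm] at h2
  linarith [dist_triangle (obsX (T n) * O * obsX (T n)) (obsX T' * O' * obsX T')
    (obsX (T N) * O * obsX (T N))]

theorem exists_limit_automorphism {T : ℕ → Finset Edge} (hT : Monotone T) :
    ∃ α : Obs ≃⋆ₐ[ℂ] Obs,
      ∀ O, Tendsto (fun n => obsX (T n) * O * obsX (T n)) atTop (𝓝 (α O)) := by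
  choose a ha using exists_tendsto_obsX_conj hT
  -- Each conjugation is a contractive involution, so `F (a O) F - O` is no larger in norm than `a O
  -- - F O F`, which tends to zero.
  have hinv : ∀ O, a (a O) = O := by
    intro O
    refine tendsto_nhds_unique (ha (a O)) ?_
    rw [tendsto_iff_norm_sub_tendsto_zero]
    have h := (tendsto_iff_norm_sub_tendsto_zero.1 (ha O))
    refine squeeze_zero (fun _ => norm_nonneg _) (fun n => ?_) h
    have h1 : obsX (T n) * a O * obsX (T n) - O =
        obsX (T n) * (a O - obsX (T n) * O * obsX (T n)) * obsX (T n) := by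
      rw [mul_sub, sub_mul]
      congr 1
      calc O = (obsX (T n) * obsX (T n)) * O * (obsX (T n) * obsX (T n)) := by
            rw [obsX_mul_self, one_mul, mul_one]
        _ = _ := by simp only [mul_assoc]
    rw [h1, norm_sub_rev (obsX (T n) * O * obsX (T n))]
    exact norm_obsX_conj_le _ _
  refine ⟨{ toFun := a
            invFun := a
            left_inv := hinv
            right_inv := hinv
            map_mul' := fun X Y => ?_
            map_add' := fun X Y => ?_
            map_star' := fun X => ?_
            map_smul' := fun c X => ?_ }, ha⟩
  · refine tendsto_nhds_unique (ha (X * Y)) (((ha X).mul (ha Y)).congr fun n => ?_)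
    calc _ = obsX (T n) * X * (obsX (T n) * obsX (T n)) * Y * obsX (T n) := by
          simp only [mul_assoc]
      _ = _ := by rw [obsX_mul_self, mul_one]; simp only [mul_assoc]
  · refine tendsto_nhds_unique (ha (X + Y)) (((ha X).add (ha Y)).congr fun n => ?_)
    rw [mul_add, add_mul]
  · refine tendsto_nhds_unique (ha (star X)) ((ha X).star.congr fun n => ?_)
    rw [star_mul, star_mul, obsX_star, mul_assoc]
  · refine tendsto_nhds_unique (ha (c • X)) (((ha X).const_smul c).congr fun n => ?_)
    rw [mul_smul_comm, smul_mul_assoc]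

/-! ### Infinite paths -/

namespace InfinitePath

variable (γ : InfinitePath)

/-- The vertex that an infinite path visits at time `t`. -/
def pos (t : ℤ) : Vertex := (γ.toFun t).source

theorem target_eq (t : ℤ) : (γ.toFun t).target = γ.pos (t + 1) := by
  have h := (γ.isFinitePath t 2).1 0 1 (by simp)
  simpa [pos] using h

theorem sum_boundary (a : ℤ) (l : ℕ) :
    ∑ i : Fin l, (γ.toFun (a + ((i : ℕ) : ℤ))).boundary =
      Finsupp.single (γ.pos (a + l)) 1 - Finsupp.single (γ.pos a) 1 := by
  induction l with
  | zero => simp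
  | succ l ih =>
    rw [Fin.sum_univ_castSucc]
    simp only [Fin.val_castSucc, Fin.val_last]
    rw [ih, OrientedEdge.boundary, target_eq, show (γ.toFun (a + l)).source = γ.pos (a + l) from rfl,
      Nat.cast_succ, ← add_assoc, sub_add_sub_comm, add_comm, add_sub_add_right_eq_sub]

theorem pos_injective : Function.Injective γ.pos := by
  have key : ∀ (a : ℤ) (l : ℕ), 0 < l → γ.pos (a + l) ≠ γ.pos a := by
    intro a l hl h
    -- A loop of length `l` is viewed inside the section of length `l + 1`, since only proper parts
    -- are forbidden to have zero boundary.
    refine (γ.isFinitePath a (l + 1)).2 (Finset.univ.map Fin.castSuccEmb) ?_ ?_ ?_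
    · exact ⟨_, Finset.mem_map_of_mem _ (Finset.mem_univ ⟨0, hl⟩)⟩
    · intro hu
      have := hu ▸ Finset.mem_univ (Fin.last l)
      simp only [Finset.mem_map, Finset.mem_univ, true_and, Fin.coe_castSuccEmb] at this
      obtain ⟨i, hi⟩ := this
      exact Fin.castSucc_ne_last i hi
    · rw [Finset.sum_map]
      simp only [Fin.coe_castSuccEmb, Fin.val_castSucc]
      rw [sum_boundary, h, sub_self]
  intro a b h
  by_contra hab
  rcases lt_or_gt_of_ne hab with hlt | hlt
  · refine key a (b - a).toNat (by omega) ?_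
    rw [h]; congr 1; omega
  · refine key b (a - b).toNat (by omega) ?_
    rw [← h]; congr 1; omega

theorem edge_mem_starEdges {t : ℤ} {v : Vertex} :
    (γ.toFun t).edge ∈ starEdges v ↔ γ.pos t = v ∨ γ.pos (t + 1) = v := by
  rw [← target_eq, mem_starEdges, pos, OrientedEdge.source, OrientedEdge.target]
  split_ifs
  · rfl
  · exact Or.comm

theorem edge_injective : Function.Injective fun t => (γ.toFun t).edge := by
  intro s t h
  change (γ.toFun s).edge = (γ.toFun t).edge at h
  have h1 := (γ.edge_mem_starEdges (t := t) (v := γ.pos s)).1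
    (h ▸ γ.edge_mem_starEdges.2 (Or.inl rfl))
  have h2 := (γ.edge_mem_starEdges (t := t) (v := γ.pos (s + 1))).1
    (h ▸ γ.edge_mem_starEdges.2 (Or.inr rfl))
  simp only [γ.pos_injective.eq_iff] at h1 h2
  omega

-- The string is a mod 2 cycle: a vertex visited at time `t` meets exactly the edges traversed at
-- times `t` and `t - 1`, any other vertex meets none.
open Classical in
theorem sum_starEdges_eq_zero (v : Vertex) :
    ∑ e ∈ starEdges v, (if e ∈ γ.edges then (1 : ZMod 2) else 0) = 0 := by
  by_cases hv : ∃ t, γ.pos t = v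
  · obtain ⟨t, rfl⟩ := hv
    have h : (starEdges (γ.pos t)).filter (· ∈ γ.edges) =
        {(γ.toFun t).edge, (γ.toFun (t - 1)).edge} := by
      ext e
      simp only [Finset.mem_filter, Finset.mem_insert, Finset.mem_singleton]
      constructor
      · rintro ⟨h1, s, rfl⟩
        rw [edge_mem_starEdges, γ.pos_injective.eq_iff, γ.pos_injective.eq_iff] at h1
        rcases h1 with rfl | rfl
        · exact Or.inl rfl
        · right; rw [add_sub_cancel_right]
      · rintro (rfl | rfl)
        · exact ⟨γ.edge_mem_starEdges.2 (Or.inl rfl), _, rfl⟩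
        · exact ⟨γ.edge_mem_starEdges.2 (Or.inr (by rw [sub_add_cancel])), _, rfl⟩
    rw [← Finset.natCast_card_filter, h, Finset.card_pair]
    · rfl
    · intro h
      have := γ.edge_injective h
      omega
  · refine Finset.sum_eq_zero fun e he => if_neg ?_
    rintro ⟨t, rfl⟩
    rcases γ.edge_mem_starEdges.1 he with h | h
    · exact hv ⟨_, h⟩
    · exact hv ⟨_, h⟩

end InfinitePath

/-! ### Locally finite cycles modulo two are boundaries -/

theorem exists_int_primitive (f : ℤ → ZMod 2) :
    ∃ F : ℤ → ZMod 2, F 0 = 0 ∧ ∀ n, F n + F (n - 1) = f n := by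
  -- One of the two intervals is always empty; together they sum outwards from `0` in both
  -- directions.
  refine ⟨fun n => ∑ k ∈ Finset.Ioc 0 n, f k + ∑ k ∈ Finset.Ioc n 0, f k, by simp, fun n => ?_⟩
  rcases le_or_gt n 0 with h | h
  · have h1 : Finset.Ioc (n - 1) 0 = insert n (Finset.Ioc n 0) := by
      ext k; simp only [Finset.mem_Ioc, Finset.mem_insert]; omega
    simp only [h1, Finset.Ioc_eq_empty_of_le h, Finset.Ioc_eq_empty_of_le (by omega : n - 1 ≤ 0)]
    rw [Finset.sum_insert (by simp), Finset.sum_empty, zero_add, zero_add, add_left_comm,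
      CharTwo.add_self_eq_zero, add_zero]
  · have h1 : Finset.Ioc 0 n = insert n (Finset.Ioc 0 (n - 1)) := by
      ext k; simp only [Finset.mem_Ioc, Finset.mem_insert]; omega
    simp only [h1, Finset.Ioc_eq_empty_of_le h.le, Finset.Ioc_eq_empty_of_le (by omega : 0 ≤ n - 1)]
    rw [Finset.sum_insert (by simp), Finset.sum_empty, add_zero, add_zero, add_assoc,
      CharTwo.add_self_eq_zero, add_zero]

theorem update_sub_unit (v : Vertex) (j : Fin 3) (n : ℤ) :
    Function.update (v - unit j) j n = Function.update v j n := by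
  ext i
  by_cases h : i = j
  · subst h; simp
  · simp [h, unit]

theorem exists_primitive (j : Fin 3) (g : Vertex → ZMod 2) :
    ∃ G : Vertex → ZMod 2, (∀ v, v j = 0 → G v = 0) ∧ ∀ v, G v + G (v - unit j) = g v := by
  choose I h0 hI using exists_int_primitive
  refine ⟨fun v => I (fun n => g (Function.update v j n)) (v j), fun v hv => ?_, fun v => ?_⟩
  · simp only [hv, h0]
  · simp only [update_sub_unit, Pi.sub_apply]
    rw [show unit j j = 1 by simp [unit], hI, Function.update_eq_self]

theorem eq_update_zero {j : Fin 3} {R : Vertex → ZMod 2} (h : ∀ v, R v = R (v - unit j))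
    (v : Vertex) : R v = R (Function.update v j 0) := by
  have key : ∀ n : ℤ, R (Function.update v j n) = R (Function.update v j 0) := by
    have hs : ∀ n, R (Function.update v j n) = R (Function.update v j (n - 1)) := by
      intro n
      rw [h]
      congr 1
      ext i
      by_cases hi : i = j
      · subst hi; simp [unit]
      · simp [hi, unit]
    intro n
    induction n using Int.induction_on with
    | zero => rfl
    | succ k ih => rw [hs, add_sub_cancel_right, ih]
    | pred k ih => rw [← ih, hs (-(k : ℤ))]
  simpa using key (v j)

/-- Use no faces of normal `2`. Integrating along axis `2` then solves the equations on the edges of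
directions `0` and `1`. The cycle condition makes the defect `R` on edges of direction `2` invariant
along axis `2`, and the constant of integration `Q` is chosen so that `R` vanishes on the slice `v 2
= 0`. -/
theorem exists_filling {z : Edge → ZMod 2}
    (hz : ∀ v, ∑ i : Fin 3, (z (v, i) + z (v - unit i, i)) = 0) :
    ∃ S : Face → ZMod 2, ∀ (v : Vertex) (i : Fin 3), S (v, i + 2) + (S (v, i + 1) +
      (S (v - unit (i + 2), i + 1) + S (v - unit (i + 1), i + 2))) = z (v, i) := by
  obtain ⟨S₁, h10, h1⟩ := exists_primitive 2 fun v => z (v, 0)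
  obtain ⟨P, hP0, hP⟩ := exists_primitive 2 fun v => z (v, 1)
  obtain ⟨Q, -, hQ⟩ := exists_primitive 1 fun v => z (v, 2)
  let S₀ : Vertex → ZMod 2 := fun v => P v + Q (Function.update v 2 0)
  have h0 : ∀ v, S₀ v + S₀ (v - unit 2) = z (v, 1) := by
    intro v
    simp only [S₀, update_sub_unit]
    rw [← hP v, add_add_add_comm, CharTwo.add_self_eq_zero, add_zero]
  let R : Vertex → ZMod 2 := fun v =>
    z (v, 2) + (S₀ v + S₀ (v - unit 1)) + (S₁ v + S₁ (v - unit 0))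
  have hR : ∀ v, R v = R (v - unit 2) := by
    intro v
    have e0 := h1 v
    have e1 := h1 (v - unit 0)
    have e2 := h0 v
    have e3 := h0 (v - unit 1)
    have e4 := hz v
    rw [Fin.sum_univ_three] at e4
    rw [sub_right_comm] at e1 e3
    rw [← CharTwo.add_eq_zero]
    simp only [R]
    linear_combination e0 + e1 + e2 + e3 + e4
  have hRz : ∀ v, R v = 0 := by
    intro v
    rw [eq_update_zero hR]
    set w := Function.update v 2 0 with hw
    have hw2 : w 2 = 0 := by simp [hw]
    have hu : ∀ i : Fin 3, i ≠ 2 → (w - unit i) 2 = 0 := by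
      intro i hi; simp [hw2, unit, hi.symm]
    have hup : ∀ w : Vertex, w 2 = 0 → Function.update w 2 0 = w := by
      intro w hw; rw [← hw, Function.update_eq_self]
    simp only [R, S₀]
    rw [h10 w hw2, h10 _ (hu 0 (by decide)), hP0 w hw2, hP0 _ (hu 1 (by decide)), hup w hw2,
      hup _ (hu 1 (by decide))]
    linear_combination hQ w + (z (w, 2)) * (CharTwo.two_eq_zero (R := ZMod 2))
  refine ⟨fun f => if f.2 = 0 then S₀ f.1 else if f.2 = 1 then S₁ f.1 else 0, fun v i => ?_⟩
  fin_cases i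
  · simpa using h1 v
  · simpa using h0 v
  · have h := hRz v
    simp only [R] at h
    simp
    linear_combination h - z (v, 2) * (CharTwo.two_eq_zero (R := ZMod 2))

/-! ### Surfaces -/

/-- The four faces that contain an edge. -/
def cofaces (e : Edge) : Finset Face :=
  {(e.1, e.2 + 2), (e.1, e.2 + 1), (e.1 - unit (e.2 + 2), e.2 + 1),
    (e.1 - unit (e.2 + 1), e.2 + 2)}

theorem mem_cofaces {e : Edge} {f : Face} : f ∈ cofaces e ↔ e ∈ faceEdges f := by
  obtain ⟨v, k⟩ := f
  obtain ⟨w, l⟩ := e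
  fin_cases k <;> fin_cases l <;>
    simp [cofaces, faceEdges, eq_sub_iff_add_eq, eq_comm]

theorem sum_cofaces {M : Type*} [AddCommMonoid M] (e : Edge) (g : Face → M) :
    ∑ f ∈ cofaces e, g f = g (e.1, e.2 + 2) + (g (e.1, e.2 + 1) +
      (g (e.1 - unit (e.2 + 2), e.2 + 1) + g (e.1 - unit (e.2 + 1), e.2 + 2))) := by
  obtain ⟨v, k⟩ := e
  have h12 : k + 1 ≠ k + 2 := by revert k; decide
  have h : ∀ i, v ≠ v - unit i := fun i h => unit_ne_zero i (sub_eq_self.1 h.symm)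
  rw [cofaces, Finset.sum_insert, Finset.sum_insert, Finset.sum_insert, Finset.sum_singleton] <;>
    simp [h12, h12.symm, h]

theorem filter_mem_faceEdges (S : Finset Face) (e : Edge) :
    S.filter (e ∈ faceEdges ·) = (cofaces e).filter (· ∈ S) := by
  ext f
  simp only [Finset.mem_filter, mem_cofaces, and_comm]

/-- The vertices with all coordinates in `[-n, n]`. -/
noncomputable def box (n : ℕ) : Finset Vertex := Finset.Icc (fun _ => -(n : ℤ)) (fun _ => (n : ℤ))

theorem mem_box {n : ℕ} {v : Vertex} : v ∈ box n ↔ ∀ j, -(n : ℤ) ≤ v j ∧ v j ≤ n := by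
  simp only [box, Finset.mem_Icc, Pi.le_def, forall_and]

theorem box_mono {m n : ℕ} (h : m ≤ n) : box m ⊆ box n := by
  intro v hv
  rw [mem_box] at hv ⊢
  intro j
  have := hv j
  omega

theorem exists_subset_box (V : Finset Vertex) : ∃ n, V ⊆ box n := by
  induction V using Finset.induction_on with
  | empty => exact ⟨0, by simp⟩
  | insert v V _ ih =>
    obtain ⟨n, hn⟩ := ih
    refine ⟨max n (∑ j, (v j).natAbs), Finset.insert_subset ?_ (hn.trans (box_mono (le_max_left _ _)))⟩
    refine box_mono (le_max_right _ _) (mem_box.2 fun j => ?_)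
    have := Finset.single_le_sum (f := fun j => (v j).natAbs) (fun _ _ => Nat.zero_le _)
      (Finset.mem_univ j)
    omega

/-- Cut an infinite filling of the string off at growing boxes. Whether an edge lies in the boundary
depends only on its four cofaces, so the answer is correct once the box contains them. -/
theorem exists_boundsPath (γ : InfinitePath) : ∃ S : ℕ → Finset Face, BoundsPath γ S := by
  classical
  obtain ⟨S, hS⟩ := exists_filling (z := fun e => if e ∈ γ.edges then 1 else 0) fun v => by
    rw [← sum_starEdges v (fun e => if e ∈ γ.edges then (1 : ZMod 2) else 0)]
    exact γ.sum_starEdges_eq_zero v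
  refine ⟨fun n => (box n ×ˢ Finset.univ).filter fun f => S f = 1, fun m n h => ?_, fun e => ?_⟩
  · exact Finset.filter_subset_filter _ (Finset.product_subset_product_left (box_mono h))
  · obtain ⟨N, hN⟩ := exists_subset_box ((cofaces e).image Prod.fst)
    filter_upwards [eventually_ge_atTop N] with n hn
    have hmem : ∀ f ∈ cofaces e, (f ∈ (box n ×ˢ Finset.univ).filter fun f => S f = 1) ↔ S f = 1 := by
      intro f hf
      simp only [Finset.mem_filter, Finset.mem_product, Finset.mem_univ, and_true,
        and_iff_right_iff_imp]
      exact fun _ => box_mono hn (hN (Finset.mem_image_of_mem _ hf))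
    have h01 : ∀ a : ZMod 2, (if a = 1 then (1 : ZMod 2) else 0) = a := by decide
    rw [surfaceBoundary, Set.mem_ofPred_eq, filter_mem_faceEdges, Finset.filter_congr hmem,
      ← ZMod.natCast_eq_one_iff_odd, Finset.natCast_card_filter]
    simp only [h01]
    rw [sum_cofaces, hS e.1 e.2]
    by_cases h : e ∈ γ.edges <;> simp [h]

/-! ### The state with an infinite flux string -/

theorem edgeOfDualFace_injective : Function.Injective edgeOfDualFace := by
  rintro ⟨v, k⟩ ⟨w, l⟩ h
  simp only [edgeOfDualFace, Prod.mk.injEq] at h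
  obtain ⟨h1, rfl⟩ := h
  simpa using h1

theorem card_image_inter_faceEdges (S : Finset Face) (f : Face) :
    (S.image edgeOfDualFace ∩ faceEdges f).card =
      (S.filter (dualEdgeOfFace f ∈ faceEdges ·)).card := by
  rw [← Finset.filter_mem_eq_inter, Finset.filter_image,
    Finset.card_image_of_injective _ edgeOfDualFace_injective]
  simp only [edgeOfDualFace_mem_faceEdges]

theorem fluxOp_conj_plaquetteOp (S : Finset Face) (f : Face) :
    fluxOp S * plaquetteOp f * fluxOp S =
      ((-1 : ℂ) ^ (S.filter (dualEdgeOfFace f ∈ faceEdges ·)).card) • plaquetteOp f := by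
  rw [fluxOp, plaquetteOp, obsX_conj_obsZ, card_image_inter_faceEdges]

open Classical in
/-- The value of `B_f` in the presence of the flux string `γ`. -/
noncomputable def fluxSign (γ : InfinitePath) (f : Face) : ℤ :=
  if dualEdgeOfFace f ∈ γ.edges then -1 else 1

theorem fluxSign_mul_self (γ : InfinitePath) (f : Face) : fluxSign γ f * fluxSign γ f = 1 := by
  unfold fluxSign
  split_ifs <;> rfl

/-- A state with all `A_v` equal to `1` and with the fluxes `B_f` of the string `γ`. -/
def IsFluxState (γ : InfinitePath) (φ : Obs →ₗ[ℂ] ℂ) : Prop :=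
  IsState φ ∧ (∀ v, φ (starOp v) = 1) ∧ ∀ f, φ (plaquetteOp f) = fluxSign γ f

theorem isFluxState_pullback {ω : Obs →ₗ[ℂ] ℂ} (hω : IsVacuum ω) {γ : InfinitePath}
    {S : ℕ → Finset Face} (hS : BoundsPath γ S) {α : Obs ≃⋆ₐ[ℂ] Obs}
    (hα : IsFluxAutomorphism S α) : IsFluxState γ (pullback ω α) := by
  obtain ⟨⟨hpos, hone⟩, hA, hB⟩ := hω
  have happ : ∀ O, pullback ω α O = ω (α O) := fun _ => rfl
  refine ⟨⟨fun O => ?_, ?_⟩, fun v => ?_, fun f => ?_⟩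
  · rw [happ, map_mul, map_star]
    exact hpos _
  · rw [happ, map_one, hone]
  · rw [happ, ← hA v]
    congr 1
    refine tendsto_nhds_unique (hα (starOp v)) (tendsto_const_nhds.congr fun n => ?_)
    rw [fluxOp, starOp, (obsX_comm _ _).eq, mul_assoc, obsX_mul_self, mul_one]
  · have h : α (plaquetteOp f) = (fluxSign γ f : ℂ) • plaquetteOp f := by
      refine tendsto_nhds_unique (hα (plaquetteOp f)) (tendsto_const_nhds.congr' ?_)
      filter_upwards [hS.2 (dualEdgeOfFace f)] with n hn
      rw [fluxOp_conj_plaquetteOp]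
      congr 1
      unfold fluxSign
      rw [surfaceBoundary, Set.mem_ofPred_eq] at hn
      split_ifs with h
      · rw [(hn.2 h).neg_one_pow]; simp
      · rw [(Nat.not_odd_iff_even.1 (mt hn.1 h)).neg_one_pow]; simp
    rw [happ, h, map_smul, hB, smul_eq_mul, mul_one]

theorem IsFluxState.map_mul_starOp {γ : InfinitePath} {φ : Obs →ₗ[ℂ] ℂ} (hφ : IsFluxState γ φ)
    (v : Vertex) (X : Obs) : φ (X * starOp v) = φ X := by
  have h := hφ.1.map_mul_of_eigen (obsX_star (starEdges v)) (obsX_mul_self _) (b := 1) rfl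
    (by rw [Int.cast_one]; exact hφ.2.1 v) X
  rwa [Int.cast_one, one_mul] at h

theorem IsFluxState.map_mul_plaquetteOp {γ : InfinitePath} {φ : Obs →ₗ[ℂ] ℂ}
    (hφ : IsFluxState γ φ) (f : Face) (X : Obs) :
    φ (X * plaquetteOp f) = fluxSign γ f * φ X :=
  hφ.1.map_mul_of_eigen (obsZ_star (faceEdges f)) (obsZ_mul_self _) (fluxSign_mul_self γ f)
    (hφ.2.2 f) X

/-! ### The derivation -/

/-- The commutator of an observable with the terms of the Hamiltonian at the vertices in `V` and
the faces in `K`. -/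
noncomputable def hamiltonianCommutator (V : Finset Vertex) (K : Finset Face) (O : Obs) : Obs :=
  ∑ v ∈ V, ((1 - starOp v) * O - O * (1 - starOp v)) +
    ∑ f ∈ K, ((1 - plaquetteOp f) * O - O * (1 - plaquetteOp f))

/-- The net is eventually constant: once `Λ` contains the supports of all terms in `V` and `K`, any
further term commutes with `O`. -/
theorem tendsto_commutator {V : Finset Vertex} {K : Finset Face} {O : Obs}
    (hV : ∀ v ∉ V, Commute (starOp v) O) (hK : ∀ f ∉ K, Commute (plaquetteOp f) O) :
    Tendsto (fun Λ : Finset Edge => Complex.I • (hamiltonian Λ * O - O * hamiltonian Λ))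
      atTop (𝓝 (Complex.I • hamiltonianCommutator V K O)) := by
  refine tendsto_const_nhds.congr' ?_
  filter_upwards [eventually_ge_atTop (V.biUnion starEdges ∪ K.biUnion faceEdges)] with Λ hΛ
  congr 1
  have hV' : V ⊆ regionVertices Λ := fun v hv => mem_regionVertices.2 <|
    (Finset.subset_biUnion_of_mem starEdges hv).trans (Finset.subset_union_left.trans hΛ)
  have hK' : K ⊆ regionFaces Λ := fun f hf => mem_regionFaces.2 <|
    (Finset.subset_biUnion_of_mem faceEdges hf).trans (Finset.subset_union_right.trans hΛ)
  have hc : ∀ X : Obs, Commute X O → (1 - X) * O - O * (1 - X) = 0 := by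
    intro X h
    rw [sub_mul, mul_sub, h.eq, one_mul, mul_one, sub_self]
  rw [hamiltonianCommutator, Finset.sum_subset hV' fun v _ h => hc _ (hV v h),
    Finset.sum_subset hK' fun f _ h => hc _ (hK f h), hamiltonian, Finset.sum_sub_distrib,
    Finset.sum_sub_distrib, add_mul, mul_add, Finset.sum_mul, Finset.sum_mul, Finset.mul_sum,
    Finset.mul_sum, add_sub_add_comm]

theorem IsGroundState.nonneg {φ : Obs →ₗ[ℂ] ℂ} (hφ : IsGroundState φ) {V : Finset Vertex}
    {K : Finset Face} {O : Obs} (hO : IsLocal O)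
    (hV : ∀ v ∉ V, Commute (starOp v) O) (hK : ∀ f ∉ K, Commute (plaquetteOp f) O) :
    0 ≤ φ (star O * hamiltonianCommutator V K O) := by
  have h := hφ.2 O _ (subset_closure ⟨hO, tendsto_commutator hV hK⟩)
  rwa [mul_smul_comm, map_smul, smul_eq_mul, ← mul_assoc, neg_mul, Complex.I_mul_I, neg_neg,
    one_mul] at h

theorem IsState.isClosed_setOf_nonneg {φ : Obs →ₗ[ℂ] ℂ} (hφ : IsState φ) :
    IsClosed {x : Obs × Obs | 0 ≤ -Complex.I * φ (star x.1 * x.2)} := by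
  have h1 : Continuous fun x : Obs × Obs => star x.1 := continuous_star.comp continuous_fst
  have h2 : Continuous fun x : Obs × Obs => star x.1 * x.2 := h1.mul continuous_snd
  have h3 : Continuous fun x : Obs × Obs => φ (star x.1 * x.2) := hφ.continuous.comp h2
  have hc : Continuous fun x : Obs × Obs => -Complex.I * φ (star x.1 * x.2) :=
    continuous_const.mul h3
  exact isClosed_le continuous_const hc

/-- States are continuous, so the ground state inequality is a closed condition and passes from the
local graph to its closure. -/
theorem isGroundState_of_local {φ : Obs →ₗ[ℂ] ℂ} (hφ : IsState φ)
    (h : ∀ (O : Obs) (Λ : Finset Edge), (O : Hilb →L[ℂ] Hilb) ∈ localAlgebra Λ →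
      ∃ (V : Finset Vertex) (K : Finset Face), (∀ v ∉ V, Commute (starOp v) O) ∧
        (∀ f ∉ K, Commute (plaquetteOp f) O) ∧ 0 ≤ φ (star O * hamiltonianCommutator V K O)) :
    IsGroundState φ := by
  refine ⟨hφ, fun O D hD => ?_⟩
  have hsub : localDerivationGraph ⊆ {x : Obs × Obs | 0 ≤ -Complex.I * φ (star x.1 * x.2)} := by
    intro x hx
    rw [localDerivationGraph, Set.mem_ofPred_eq] at hx
    obtain ⟨hl, hlim⟩ := hx
    obtain ⟨Λ, hΛ⟩ := hl
    obtain ⟨V, K, hV, hK, h0⟩ := h x.1 Λ hΛ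
    have hx : x.2 = Complex.I • hamiltonianCommutator V K x.1 :=
      tendsto_nhds_unique hlim (tendsto_commutator hV hK)
    rw [Set.mem_ofPred_eq, hx, mul_smul_comm, map_smul, smul_eq_mul, ← mul_assoc, neg_mul,
      Complex.I_mul_I, neg_neg, one_mul]
    exact h0
  have hmem := closure_minimal hsub hφ.isClosed_setOf_nonneg hD
  rwa [Set.mem_ofPred_eq] at hmem

/-! ### Energy estimates -/

/-- `A` is a positive multiple of a projection, so `O* A O = (A O)* (A O) / c`. -/
theorem IsState.nonneg_of_mul_self {φ : Obs →ₗ[ℂ] ℂ} (hφ : IsState φ) {A : Obs} (hs : star A = A)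
    {c : ℝ} (hc : 0 < c) (hA : A * A = (c : ℂ) • A) (O : Obs) : 0 ≤ φ (star O * A * O) := by
  have h := hφ.1 (A * O)
  have h1 : star (A * O) * (A * O) = (c : ℂ) • (star O * A * O) := by
    rw [star_mul, hs, mul_assoc, ← mul_assoc A A O, hA, smul_mul_assoc, mul_smul_comm, mul_assoc]
  rw [h1, map_smul, smul_eq_mul] at h
  have hc' : (0 : ℂ) < c := by exact_mod_cast hc
  exact le_of_mul_le_mul_left (by rwa [mul_zero]) hc'

theorem one_sub_mul_self {B : Obs} (hB : B * B = 1) :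
    (1 - B) * (1 - B) = ((2 : ℝ) : ℂ) • (1 - B) := by
  rw [mul_sub, sub_mul, sub_mul, hB, Complex.ofReal_ofNat, two_smul]
  simp only [mul_one, one_mul]
  abel

theorem IsFluxState.star_energy_nonneg {γ : InfinitePath} {φ : Obs →ₗ[ℂ] ℂ}
    (hφ : IsFluxState γ φ) (v : Vertex) (O : Obs) :
    0 ≤ φ (star O * ((1 - starOp v) * O - O * (1 - starOp v))) := by
  have h := hφ.1.nonneg_of_mul_self (A := 1 - starOp v) (by
    rw [star_sub, star_one, starOp, obsX_star]) two_pos (one_sub_mul_self (obsX_mul_self _)) O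
  have h1 : φ (star O * (O * (1 - starOp v))) = 0 := by
    rw [← mul_assoc, mul_sub, mul_one, map_sub, hφ.map_mul_starOp, sub_self]
  rw [mul_sub, map_sub, h1, sub_zero, ← mul_assoc]
  exact h

/-- `U` is the mod 2 boundary of `P`, so `obsZ U = ∏ B_f`. The last bound is inductive: for
commuting involutions `1 - BC = (1 - B) + (1 - C) - (1 - B)(1 - C)`, and the final product is
positive because it squares to `4` times itself. -/
theorem IsFluxState.exists_plaquette_product {γ : InfinitePath} {φ : Obs →ₗ[ℂ] ℂ}
    (hφ : IsFluxState γ φ) (P : Finset Face) :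
    ∃ U : Finset Edge, (∀ e, e ∈ U ↔ Odd (P.filter (e ∈ faceEdges ·)).card) ∧
      (∀ X, φ (X * obsZ U) = (∏ f ∈ P, fluxSign γ f : ℤ) * φ X) ∧
      ∀ O, φ (star O * (1 - obsZ U) * O) ≤ φ (star O * (∑ f ∈ P, (1 - plaquetteOp f)) * O) := by
  induction P using Finset.induction_on with
  | empty => exact ⟨∅, by simp, by simp [obsZ_empty], by simp [obsZ_empty]⟩
  | insert f P hf ih =>
    obtain ⟨U, h1, h2, h3⟩ := ih
    have hmul : obsZ (symmDiff (faceEdges f) U) = plaquetteOp f * obsZ U :=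
      (obsZ_mul _ _).symm
    have hcomm : Commute (plaquetteOp f) (obsZ U) := obsZ_comm _ _
    have hcomm' : Commute (1 - plaquetteOp f) (1 - obsZ U) :=
      ((Commute.one_left _).sub_left ((Commute.one_right _).sub_right hcomm))
    refine ⟨symmDiff (faceEdges f) U, fun e => ?_, fun X => ?_, fun O => ?_⟩
    · rw [Finset.filter_insert, Finset.mem_symmDiff, h1]
      split_ifs with h
      · rw [Finset.card_insert_of_notMem (by simp [hf]), Nat.odd_add_one]
        simp [h]
      · simp [h]
    · rw [hmul, hcomm.eq, ← mul_assoc, hφ.map_mul_plaquetteOp, h2, Finset.prod_insert hf]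
      push_cast
      ring
    · have h4 := hφ.1.nonneg_of_mul_self (A := (1 - plaquetteOp f) * (1 - obsZ U)) (c := 4) (by
        rw [star_mul, star_sub, star_sub, star_one, obsZ_star, plaquetteOp, obsZ_star]
        exact hcomm'.eq.symm) (by norm_num) (by
          rw [mul_assoc, ← mul_assoc (1 - obsZ U), ← hcomm'.eq, mul_assoc,
            one_sub_mul_self (obsZ_mul_self U), ← mul_assoc,
            one_sub_mul_self (show plaquetteOp f * plaquetteOp f = 1 from obsZ_mul_self _), mul_smul_comm, smul_mul_assoc,
            smul_smul]
          norm_num) O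
      have h5 : 1 - plaquetteOp f * obsZ U =
          (1 - plaquetteOp f) + (1 - obsZ U) - (1 - plaquetteOp f) * (1 - obsZ U) := by
        noncomm_ring
      rw [hmul, Finset.sum_insert hf, h5, mul_sub, sub_mul, mul_add, add_mul, mul_add, add_mul,
        map_sub, map_add, map_add]
      exact (sub_le_self _ h4).trans (add_le_add_right (h3 O) _)

/-- By `hΛ` the boundary of `P` avoids `Λ`, so `∏ B_f` commutes with `O` and the flux parity through
`P` is conserved. `hP` says that `φ` already has the least energy on `P` allowed by that parity. -/
theorem IsFluxState.face_energy_nonneg {γ : InfinitePath} {φ : Obs →ₗ[ℂ] ℂ}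
    (hφ : IsFluxState γ φ) {P : Finset Face} {Λ : Finset Edge} {O : Obs}
    (hO : (O : Hilb →L[ℂ] Hilb) ∈ localAlgebra Λ)
    (hΛ : ∀ e ∈ Λ, Even (P.filter (e ∈ faceEdges ·)).card)
    (hP : ∑ f ∈ P, (1 - fluxSign γ f) = 1 - ∏ f ∈ P, fluxSign γ f) :
    0 ≤ φ (star O * ∑ f ∈ P, ((1 - plaquetteOp f) * O - O * (1 - plaquetteOp f))) := by
  obtain ⟨U, h1, h2, h3⟩ := hφ.exists_plaquette_product P
  have hU : Commute (obsZ U) O := obsZ_comm_of_disjoint hO <| Finset.disjoint_left.2 fun e he h =>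
    Nat.not_odd_iff_even.2 (hΛ e h) ((h1 e).1 he)
  have h4 : φ (star O * (1 - obsZ U) * O) = (1 - ∏ f ∈ P, fluxSign γ f : ℤ) * φ (star O * O) := by
    rw [mul_assoc, sub_mul, hU.eq, one_mul, mul_sub, map_sub, ← mul_assoc, h2]
    push_cast
    ring
  have h5 : φ (star O * ∑ f ∈ P, O * (1 - plaquetteOp f)) =
      (1 - ∏ f ∈ P, fluxSign γ f : ℤ) * φ (star O * O) := by
    rw [← hP, Finset.mul_sum, map_sum, Int.cast_sum, Finset.sum_mul]
    refine Finset.sum_congr rfl fun f _ => ?_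
    rw [← mul_assoc, mul_sub, mul_one, map_sub, hφ.map_mul_plaquetteOp]
    push_cast
    ring
  rw [Finset.sum_sub_distrib, mul_sub, map_sub, ← Finset.sum_mul, ← mul_assoc, h5, ← h4, sub_nonneg]
  exact h3 O

/-! ### Monotonic strings are ground states -/

namespace InfinitePath

variable {γ : InfinitePath}

theorem pos_of_forward {t : ℤ} (h : (γ.toFun t).forward = true) :
    γ.pos t = (γ.toFun t).edge.1 ∧
      γ.pos (t + 1) = (γ.toFun t).edge.1 + unit (γ.toFun t).edge.2 := by
  rw [← target_eq, pos, OrientedEdge.source, OrientedEdge.target, if_pos h, if_pos h]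
  exact ⟨rfl, rfl⟩

theorem pos_of_backward {t : ℤ} (h : (γ.toFun t).forward = false) :
    γ.pos t = (γ.toFun t).edge.1 + unit (γ.toFun t).edge.2 ∧
      γ.pos (t + 1) = (γ.toFun t).edge.1 := by
  rw [← target_eq, pos, OrientedEdge.source, OrientedEdge.target]
  simp [h]

theorem pos_succ_of_ne {t : ℤ} {k : Fin 3} (h : (γ.toFun t).edge.2 ≠ k) :
    γ.pos (t + 1) k = γ.pos t k := by
  cases hf : (γ.toFun t).forward
  · rw [(pos_of_backward hf).1, (pos_of_backward hf).2]; simp [unit, h.symm]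
  · rw [(pos_of_forward hf).1, (pos_of_forward hf).2]; simp [unit, h.symm]

/-- The `k`-th coordinate of the position is monotone in time and changes strictly at each step
along `k`, so no layer is crossed twice. -/
theorem IsMonotonic.crossing_unique (hγ : γ.IsMonotonic) {s t : ℤ} {k : Fin 3}
    (hs : (γ.toFun s).edge.2 = k) (ht : (γ.toFun t).edge.2 = k)
    (h : (γ.toFun s).edge.1 k = (γ.toFun t).edge.1 k) : s = t := by
  obtain ⟨σ, hσ⟩ := hγ
  have hfw : ∀ t, (γ.toFun t).edge.2 = k → (γ.toFun t).forward = σ k := by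
    intro t ht
    have := hσ ⟨t, rfl⟩
    simp only [Set.mem_iUnion, OrientedEdge.pointing, Set.mem_ofPred_eq] at this
    obtain ⟨r, h1, h2⟩ := this
    rw [h2, ← ht, h1]
  have hk : unit k k = 1 := by simp [unit]
  by_contra hne
  wlog hlt : s < t generalizing s t
  · exact this ht hs h.symm (Ne.symm hne) (by omega)
  cases hσk : σ k
  · have hm : Antitone fun t => γ.pos t k := by
      refine antitone_int_of_succ_le fun n => ?_
      by_cases hn : (γ.toFun n).edge.2 = k
      · have h1 := pos_of_backward ((hfw n hn).trans hσk)
        rw [h1.1, h1.2, hn, Pi.add_apply, hk]; omega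
      · exact (pos_succ_of_ne hn).le
    have h1 := hm (show s + 1 ≤ t by omega)
    simp only [(pos_of_backward ((hfw s hs).trans hσk)).2,
      (pos_of_backward ((hfw t ht).trans hσk)).1, ht, Pi.add_apply, hk] at h1
    omega
  · have hm : Monotone fun t => γ.pos t k := by
      refine monotone_int_of_le_succ fun n => ?_
      by_cases hn : (γ.toFun n).edge.2 = k
      · have h1 := pos_of_forward ((hfw n hn).trans hσk)
        rw [h1.1, h1.2, hn, Pi.add_apply, hk]; omega
      · exact (pos_succ_of_ne hn).ge
    have h1 := hm (show s + 1 ≤ t by omega)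
    simp only [(pos_of_forward ((hfw s hs).trans hσk)).2,
      (pos_of_forward ((hfw t ht).trans hσk)).1, hs, Pi.add_apply, hk] at h1
    omega

end InfinitePath

theorem dualEdgeOfFace_injective : Function.Injective dualEdgeOfFace := by
  rintro ⟨v, k⟩ ⟨w, l⟩ h
  simp only [dualEdgeOfFace, Prod.mk.injEq] at h
  obtain ⟨h1, rfl⟩ := h
  simpa using h1

theorem sum_one_sub_fluxSign {γ : InfinitePath} (hγ : γ.IsMonotonic) {P : Finset Face}
    {k : Fin 3} {c : ℤ} (hP : ∀ f ∈ P, f.2 = k ∧ f.1 k = c) :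
    ∑ f ∈ P, (1 - fluxSign γ f) = 1 - ∏ f ∈ P, fluxSign γ f := by
  by_cases h : ∃ f₀ ∈ P, dualEdgeOfFace f₀ ∈ γ.edges
  · obtain ⟨f₀, hf₀, s, hs⟩ := h
    have hone : ∀ f ∈ P, f ≠ f₀ → fluxSign γ f = 1 := by
      intro f hf hne
      refine if_neg ?_
      rintro ⟨t, ht⟩
      refine hne (dualEdgeOfFace_injective ?_)
      rw [← hs, ← ht]
      congr 2
      refine hγ.crossing_unique (k := k) ?_ ?_ ?_
      · rw [ht]; exact (hP f hf).1
      · rw [hs]; exact (hP f₀ hf₀).1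
      · simp only [ht, hs, dualEdgeOfFace, Pi.sub_apply, (hP f hf).2, (hP f₀ hf₀).2, (hP f hf).1,
          (hP f₀ hf₀).1]
    rw [Finset.sum_eq_single f₀ (fun f hf hne => by rw [hone f hf hne, sub_self])
      (fun h => absurd hf₀ h), Finset.prod_eq_single f₀ hone (fun h => absurd hf₀ h)]
  · have hone : ∀ f ∈ P, fluxSign γ f = 1 := fun f hf => if_neg fun hmem => h ⟨f, hf, hmem⟩
    rw [Finset.sum_eq_zero fun f hf => by rw [hone f hf, sub_self], Finset.prod_eq_one hone,
      sub_self]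

theorem mem_box_add_of_faceEdges {n : ℕ} {e : Edge} {f : Face} (h : e ∈ faceEdges f)
    (he : e.1 ∈ box n) : f.1 ∈ box (n + 1) := by
  have hu : ∀ i j : Fin 3, 0 ≤ unit i j ∧ unit i j ≤ 1 := by
    intro i j
    by_cases hij : j = i <;> simp [unit, hij]
  rw [mem_box] at he ⊢
  intro j
  have h1 := he j
  simp only [faceEdges, Finset.mem_insert, Finset.mem_singleton] at h
  have h2 := hu (f.2 + 1) j
  have h3 := hu (f.2 + 2) j
  rcases h with rfl | rfl | rfl | rfl <;> simp only [Pi.add_apply] at h1 <;> push_cast <;> omega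

theorem mem_box_add_of_starEdges {n : ℕ} {e : Edge} {v : Vertex} (h : e ∈ starEdges v)
    (he : e.1 ∈ box n) : v ∈ box (n + 1) := by
  rw [mem_box] at he ⊢
  intro j
  have h1 := he j
  have h2 : 0 ≤ unit e.2 j ∧ unit e.2 j ≤ 1 := by
    by_cases hij : j = e.2 <;> simp [unit, hij]
  rcases mem_starEdges.1 h with rfl | rfl
  · push_cast; omega
  · simp only [Pi.add_apply]; push_cast; omega

/-- The four cofaces of an edge form two coplanar pairs, and the margin of one in `box (n + 1)`
ensures that none is cut off. -/
theorem even_card_plane {n : ℕ} {e : Edge} (he : e.1 ∈ box n) (p : Fin 3 × ℤ) :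
    Even ((((box (n + 1) ×ˢ Finset.univ).filter
      fun f : Face => (f.2, f.1 f.2) = p).filter (e ∈ faceEdges ·)).card) := by
  have hmem : ∀ f ∈ cofaces e, (f ∈ (box (n + 1) ×ˢ Finset.univ).filter
      fun f : Face => (f.2, f.1 f.2) = p) ↔ (f.2, f.1 f.2) = p := by
    intro f hf
    simp only [Finset.mem_filter, Finset.mem_product, Finset.mem_univ, and_true,
      and_iff_right_iff_imp]
    exact fun _ => mem_box_add_of_faceEdges (mem_cofaces.1 hf) he
  obtain ⟨w, i⟩ := e
  have h12 : ∀ i : Fin 3, i + 1 ≠ i + 2 := by decide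
  have h1 : (w - unit (i + 2)) (i + 1) = w (i + 1) := by simp [unit, h12]
  have h2 : (w - unit (i + 1)) (i + 2) = w (i + 2) := by simp [unit, (h12 _).symm]
  rw [filter_mem_faceEdges, Finset.filter_congr hmem, ← ZMod.natCast_eq_zero_iff_even,
    Finset.natCast_card_filter, sum_cofaces]
  simp only [h1, h2]
  generalize (if (i + 2, w (i + 2)) = p then (1 : ZMod 2) else 0) = a
  generalize (if (i + 1, w (i + 1)) = p then (1 : ZMod 2) else 0) = b
  revert a b
  decide

theorem IsFluxState.isGroundState {γ : InfinitePath} {φ : Obs →ₗ[ℂ] ℂ} (hφ : IsFluxState γ φ)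
    (hγ : γ.IsMonotonic) : IsGroundState φ := by
  refine isGroundState_of_local hφ.1 fun O Λ hO => ?_
  obtain ⟨n, hn⟩ := exists_subset_box (Λ.image Prod.fst)
  have hbox : ∀ e ∈ Λ, e.1 ∈ box n := fun e he => hn (Finset.mem_image_of_mem _ he)
  refine ⟨box (n + 1), box (n + 1) ×ˢ Finset.univ, fun v hv => ?_, fun f hf => ?_, ?_⟩
  · exact obsX_comm_of_disjoint hO <| Finset.disjoint_left.2 fun e h1 h2 =>
      hv (mem_box_add_of_starEdges h1 (hbox e h2))
  · exact obsZ_comm_of_disjoint hO <| Finset.disjoint_left.2 fun e h1 h2 =>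
      hf (Finset.mem_product.2 ⟨mem_box_add_of_faceEdges h1 (hbox e h2), Finset.mem_univ _⟩)
  · rw [hamiltonianCommutator, mul_add, map_add]
    refine add_nonneg ?_ ?_
    · rw [Finset.mul_sum, map_sum]
      exact Finset.sum_nonneg fun v _ => hφ.star_energy_nonneg v O
    -- Group the faces by the plane containing them, labelled by normal direction and height.
    · rw [← Finset.sum_fiberwise_of_maps_to (g := fun f : Face => (f.2, f.1 f.2))
        (fun f hf => Finset.mem_image_of_mem _ hf), Finset.mul_sum, map_sum]
      refine Finset.sum_nonneg fun p _ => hφ.face_energy_nonneg hO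
        (fun e he => even_card_plane (hbox e he) p)
        (sum_one_sub_fluxSign hγ (k := p.1) (c := p.2) fun f hf => ?_)
      have := (Finset.mem_filter.1 hf).2
      rw [← this]
      exact ⟨rfl, rfl⟩

/-! ### Shortening strings that are not monotonic -/

theorem InfinitePath.exists_opposite_steps {γ : InfinitePath} (hγ : ¬ γ.IsMonotonic) :
    ∃ s t : ℤ, s < t ∧ (γ.toFun s).edge.2 = (γ.toFun t).edge.2 ∧
      (γ.toFun s).forward ≠ (γ.toFun t).forward ∧
      ∀ j, s < j → j < t → (γ.toFun j).edge.2 ≠ (γ.toFun s).edge.2 := by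
  classical
  have h1 : ∃ a b : ℤ, (γ.toFun a).edge.2 = (γ.toFun b).edge.2 ∧
      (γ.toFun a).forward ≠ (γ.toFun b).forward := by
    by_contra! h
    -- An axis gets the positive sign if some step uses it; an axis never traversed defaults to the
    -- negative one.
    refine hγ ⟨fun r => decide (∃ t, (γ.toFun t).edge.2 = r ∧ (γ.toFun t).forward = true), ?_⟩
    rintro _ ⟨t, rfl⟩
    simp only [Set.mem_iUnion, OrientedEdge.pointing, Set.mem_ofPred_eq]
    refine ⟨_, rfl, ?_⟩
    cases ht : (γ.toFun t).forward
    · symm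
      rw [decide_eq_false_iff_not]
      rintro ⟨s, h2, h3⟩
      rw [h s t h2, ht] at h3
      exact Bool.false_ne_true h3
    · exact (decide_eq_true ⟨t, rfl, ht⟩).symm
  obtain ⟨a, b, hab, hf⟩ := h1
  wlog hlt : a < b generalizing a b
  · refine this b a hab.symm hf.symm (lt_of_le_of_ne (by omega) ?_)
    rintro rfl
    exact hf rfl
  obtain ⟨n, hn⟩ : ∃ n : ℕ, (b - a).toNat = n := ⟨_, rfl⟩
  induction n using Nat.strong_induction_on generalizing a b with
  | _ n ih =>
    -- An intermediate step along the same axis is opposite to one of the two ends, which gives a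
    -- closer pair.
    by_cases hj : ∃ j, a < j ∧ j < b ∧ (γ.toFun j).edge.2 = (γ.toFun a).edge.2
    · obtain ⟨j, h1, h2, h3⟩ := hj
      by_cases h4 : (γ.toFun j).forward = (γ.toFun a).forward
      · exact ih (b - j).toNat (by omega) j b (h3.trans hab) (h4 ▸ hf) h2 rfl
      · exact ih (j - a).toNat (by omega) a j h3.symm (Ne.symm h4) h1 rfl
    · push Not at hj
      exact ⟨a, b, hlt, hab, hf, hj⟩

/-- For distinct `i` and `r` the third direction is `-(i + r)`, as `0 + 1 + 2 = 0` in `Fin 3`. -/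
theorem sum_faceEdges_of_ne {M : Type*} [AddCommMonoid M] (w : Vertex) {i r : Fin 3} (h : i ≠ r)
    (g : Edge → M) : ∑ e ∈ faceEdges (w, -(i + r)), g e =
      (g (w, i) + g (w + unit r, i)) + (g (w, r) + g (w + unit i, r)) := by
  rw [sum_faceEdges]
  have hk : (-(i + r) + 1 = i ∧ -(i + r) + 2 = r) ∨ (-(i + r) + 1 = r ∧ -(i + r) + 2 = i) := by
    revert i r; decide
  rcases hk with ⟨h1, h2⟩ | ⟨h1, h2⟩ <;> simp only [h1, h2] <;> abel

theorem sum_Ioo_telescope (h : ℤ → ZMod 2) {s t : ℤ} (hst : s + 1 ≤ t) :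
    ∑ j ∈ Finset.Ioo s t, (h j + h (j + 1)) = h (s + 1) + h t := by
  induction t, hst using Int.leInduction with
  | base =>
    have : Finset.Ioo s (s + 1) = ∅ := by
      ext j; simp only [Finset.mem_Ioo, Finset.notMem_empty, iff_false]; omega
    rw [this, Finset.sum_empty, CharTwo.add_self_eq_zero]
  | succ t ht ih =>
    have : Finset.Ioo s (t + 1) = insert t (Finset.Ioo s t) := by
      ext j; simp only [Finset.mem_Ioo, Finset.mem_insert]; omega
    rw [this, Finset.sum_insert (by simp), ih]
    linear_combination h t * (CharTwo.two_eq_zero (R := ZMod 2))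

theorem sum_ite_eq_mem_image {ι : Type*} {I : Finset ι} {g : ι → Edge} (hg : Set.InjOn g I)
    (e : Edge) : ∑ j ∈ I, (if e = g j then (1 : ZMod 2) else 0) =
      if e ∈ I.image g then 1 else 0 := by
  rw [← Finset.sum_image (f := fun x => if e = x then (1 : ZMod 2) else 0) hg, Finset.sum_ite_eq]

/-- The faces swept by a section of a path that runs perpendicular to the axis `r`, between two
opposite steps along `r`, when the section is translated by one unit so as to cancel these steps:
the new string has two edges less. -/
theorem InfinitePath.exists_shortening {γ : InfinitePath} (hγ : ¬ γ.IsMonotonic) :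
    ∃ (W : Finset Face) (A G : Finset Edge), (A : Set Edge) ⊆ γ.edges ∧ G.card < A.card ∧
      ∀ e, Odd (W.filter (e ∈ faceEdges ·)).card ↔ e ∈ symmDiff A G := by
  obtain ⟨s, t, hst, hr, hf, hj⟩ := γ.exists_opposite_steps hγ
  obtain ⟨r, hs⟩ : ∃ r, (γ.toFun s).edge.2 = r := ⟨_, rfl⟩
  have ht : (γ.toFun t).edge.2 = r := hr ▸ hs
  rw [hs] at hj
  let b : Bool := (γ.toFun s).forward
  -- `opp` translates the section against its first step. `low v` is the base point of the `r`-edge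
  -- joining `v` to `opp v`, whichever way the translation goes.
  let low : Vertex → Vertex := fun v => if b then v - unit r else v
  let opp : Vertex → Vertex := fun v => if b then v - unit r else v + unit r
  let g : ℤ → Edge := fun j => (opp (γ.toFun j).edge.1, (γ.toFun j).edge.2)
  let F : ℤ → Face := fun j => (low (γ.toFun j).edge.1, -((γ.toFun j).edge.2 + r))
  have hlow_inj : Function.Injective low := by
    intro v w h; simp only [low] at h; split_ifs at h <;> simpa using h
  have hopp_inj : Function.Injective opp := by
    intro v w h; simp only [opp] at h; split_ifs at h <;> simpa using h
  have hlow_add : ∀ v w, low (v + w) = low v + w := by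
    intro v w; simp only [low]; split_ifs <;> abel
  have hg : Function.Injective g := by
    intro i j h
    simp only [g, Prod.mk.injEq] at h
    exact γ.edge_injective (Prod.ext (hopp_inj h.1) h.2)
  have hF : Function.Injective F := by
    intro i j h
    simp only [F, Prod.mk.injEq, neg_inj, add_left_inj] at h
    exact γ.edge_injective (Prod.ext (hlow_inj h.1) h.2)
  refine ⟨(Finset.Ioo s t).image F, (Finset.Icc s t).image fun j => (γ.toFun j).edge,
    (Finset.Ioo s t).image g, ?_, ?_, fun e => ?_⟩
  · intro e he
    simp only [Finset.coe_image, Set.mem_image] at he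
    obtain ⟨j, -, rfl⟩ := he
    exact ⟨j, rfl⟩
  · rw [Finset.card_image_of_injective _ hg, Finset.card_image_of_injective _ γ.edge_injective,
      Int.card_Ioo, Int.card_Icc]
    omega
  · have hlow_s : (low (γ.pos (s + 1)), r) = (γ.toFun s).edge := by
      refine Prod.ext ?_ hs.symm
      by_cases hb : (γ.toFun s).forward = true
      · simp [low, b, hb, pos_of_forward hb, hs]
      · simp [low, b, hb, pos_of_backward (Bool.eq_false_of_not_eq_true hb)]
    have hlow_t : (low (γ.pos t), r) = (γ.toFun t).edge := by
      refine Prod.ext ?_ ht.symm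
      by_cases hb : (γ.toFun s).forward = true
      · have hb' : (γ.toFun t).forward = false := by
          rw [hb] at hf; exact Bool.eq_false_of_not_eq_true hf.symm
        simp [low, b, hb, pos_of_backward hb', ht]
      · have hb' : (γ.toFun t).forward = true := by
          rw [Bool.eq_false_of_not_eq_true hb] at hf; exact Bool.eq_true_of_not_eq_false hf.symm
        simp [low, b, hb, pos_of_forward hb']
    let χ : Edge → ZMod 2 := fun x => if e = x then 1 else 0
    -- A swept square has four sides: the edge, its translate, and two rungs along `r`, which
    -- telescope over the section.
    have hface : ∀ j ∈ Finset.Ioo s t, (if e ∈ faceEdges (F j) then (1 : ZMod 2) else 0) =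
        (χ (γ.toFun j).edge + χ (g j)) +
          (χ (low (γ.pos j), r) + χ (low (γ.pos (j + 1)), r)) := by
      intro j hjm
      rw [Finset.mem_Ioo] at hjm
      rw [← Finset.sum_ite_eq (faceEdges (F j)) e fun _ => (1 : ZMod 2),
        sum_faceEdges_of_ne _ (hj j hjm.1 hjm.2), ← hlow_add _ (unit (γ.toFun j).edge.2)]
      congr 1
      · simp only [χ, g, low, opp]
        by_cases hb : b = true
        · simp only [hb, if_true, sub_add_cancel]; exact add_comm _ _
        · simp only [hb]; rfl
      · cases hfj : (γ.toFun j).forward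
        · rw [(pos_of_backward hfj).1, (pos_of_backward hfj).2]; exact add_comm _ _
        · rw [(pos_of_forward hfj).1, (pos_of_forward hfj).2]
    have hIcc : Finset.Icc s t = insert s (insert t (Finset.Ioo s t)) := by
      ext j; simp only [Finset.mem_Icc, Finset.mem_insert, Finset.mem_Ioo]; omega
    have hA := sum_ite_eq_mem_image (I := Finset.Icc s t) (γ.edge_injective.injOn) e
    have hG := sum_ite_eq_mem_image (I := Finset.Ioo s t) (hg.injOn) e
    rw [hIcc, Finset.sum_insert (by simp [hst.ne]), Finset.sum_insert (by simp), ← hIcc] at hA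
    rw [← ZMod.natCast_eq_one_iff_odd, Finset.natCast_card_filter, Finset.sum_image hF.injOn,
      Finset.sum_congr rfl hface, Finset.sum_add_distrib, Finset.sum_add_distrib,
      sum_Ioo_telescope (fun j => χ (low (γ.pos j), r)) (by omega), hlow_s, hlow_t]
    have htot : ∑ j ∈ Finset.Ioo s t, χ (γ.toFun j).edge + ∑ j ∈ Finset.Ioo s t, χ (g j) +
        (χ (γ.toFun s).edge + χ (γ.toFun t).edge) =
        (if e ∈ (Finset.Icc s t).image fun j => (γ.toFun j).edge then 1 else 0) +
          if e ∈ (Finset.Ioo s t).image g then 1 else 0 := by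
      rw [← hA, ← hG]; simp only [χ]; ring
    rw [htot, Finset.mem_symmDiff]
    generalize (Finset.Icc s t).image (fun j => (γ.toFun j).edge) = A
    generalize (Finset.Ioo s t).image g = G
    by_cases h1 : e ∈ A <;> by_cases h2 : e ∈ G <;> simp [h1, h2, CharTwo.add_self_eq_zero]

/-- Every edge of `A \ G` contributes `-1`, every edge of `G \ A` at most `1`, and `A \ G` is the
larger set. -/
theorem sum_symmDiff_sign_neg {A G : Finset Edge} {E : Set Edge} [DecidablePred (· ∈ E)]
    (hA : (A : Set Edge) ⊆ E) (hc : G.card < A.card) :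
    ∑ e ∈ symmDiff A G, (if e ∈ E then (-1 : ℤ) else 1) < 0 := by
  have h1 : ∑ e ∈ A \ G, (if e ∈ E then (-1 : ℤ) else 1) = -(A \ G).card := by
    rw [Finset.sum_congr rfl fun e he => if_pos (hA (Finset.mem_sdiff.1 he).1)]
    simp
  have h2 : ∑ e ∈ G \ A, (if e ∈ E then (-1 : ℤ) else 1) ≤ (G \ A).card := by
    refine (Finset.sum_le_card_nsmul _ _ 1 fun e _ => ?_).trans (by simp)
    split_ifs <;> norm_num
  rw [symmDiff_def, Finset.sup_eq_union, Finset.sum_union disjoint_sdiff_sdiff, h1]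
  have h3 := Finset.card_sdiff_add_card_inter A G
  have h4 := Finset.card_sdiff_add_card_inter G A
  rw [Finset.inter_comm] at h4
  omega

theorem IsFluxState.isMonotonic {γ : InfinitePath} {φ : Obs →ₗ[ℂ] ℂ} (hφ : IsFluxState γ φ)
    (hground : IsGroundState φ) : γ.IsMonotonic := by
  classical
  by_contra hγ
  obtain ⟨W, A, G, hA, hc, hW⟩ := γ.exists_shortening hγ
  let K : Finset Face := (symmDiff A G).image fun e => (e.1 + unit e.2, e.2)
  have hinv : ∀ e : Edge, dualEdgeOfFace (e.1 + unit e.2, e.2) = e := fun e => by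
    simp [dualEdgeOfFace]
  have hK : ∀ f, f ∈ K ↔ dualEdgeOfFace f ∈ symmDiff A G := by
    intro f
    simp only [K, Finset.mem_image]
    constructor
    · rintro ⟨e, he, rfl⟩; rwa [hinv]
    · exact fun h => ⟨_, h, by simp [dualEdgeOfFace]⟩
  -- The test operator `F_W` flips exactly the `B_f` with `f ∈ K`, each at an energy cost of `2
  -- φ(B_f)`; the total cost is negative since the new string is shorter.
  have hnonneg := hground.nonneg (V := ∅) (K := K) (O := fluxOp W) (isLocal_obsX _)
    (fun v _ => obsX_comm _ _) (fun f hf => by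
      refine (obsX_comm_obsZ ?_).symm
      rw [card_image_inter_faceEdges, ← Nat.not_odd_iff_even, hW, ← hK]
      exact hf)
  have hterm : ∀ f ∈ K, φ (fluxOp W * ((1 - plaquetteOp f) * fluxOp W -
      fluxOp W * (1 - plaquetteOp f))) = ((2 * fluxSign γ f : ℤ) : ℂ) := by
    intro f hf
    have hs : fluxOp W * fluxOp W = 1 := obsX_mul_self _
    have h1 := fluxOp_conj_plaquetteOp W f
    rw [((hW _).2 ((hK f).1 hf)).neg_one_pow, neg_one_smul] at h1
    have h2 : fluxOp W * ((1 - plaquetteOp f) * fluxOp W - fluxOp W * (1 - plaquetteOp f)) =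
        plaquetteOp f + plaquetteOp f := by
      rw [mul_sub, sub_mul, one_mul, mul_sub, ← mul_assoc, ← mul_assoc, hs, h1, one_mul]
      abel
    rw [h2, map_add, hφ.2.2]
    push_cast
    ring
  rw [hamiltonianCommutator, Finset.sum_empty, zero_add, show star (fluxOp W) = fluxOp W from
    obsX_star _, Finset.mul_sum, map_sum, Finset.sum_congr rfl hterm, ← Int.cast_sum,
    ← Finset.mul_sum] at hnonneg
  have h0 : 0 ≤ 2 * ∑ f ∈ K, fluxSign γ f := by exact_mod_cast hnonneg
  have hsum : ∑ f ∈ K, fluxSign γ f =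
      ∑ e ∈ symmDiff A G, (if e ∈ γ.edges then (-1 : ℤ) else 1) := by
    rw [Finset.sum_image fun e _ e' _ h => by rw [← hinv e, ← hinv e']; exact congrArg _ h]
    refine Finset.sum_congr rfl fun e _ => ?_
    rw [fluxSign, hinv]
  have := sum_symmDiff_sign_neg (E := γ.edges) hA hc
  omega

end ToricCode3D

theorem mainTheorem2 :
    (∃ ω : ToricCode3D.Obs →ₗ[ℂ] ℂ, ToricCode3D.IsVacuum ω) ∧
    ∀ (ω : ToricCode3D.Obs →ₗ[ℂ] ℂ), ToricCode3D.IsVacuum ω →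
    ∀ (γ : ToricCode3D.InfinitePath),
      (∃ S : ℕ → Finset ToricCode3D.Face, ToricCode3D.BoundsPath γ S) ∧
      ∀ (S : ℕ → Finset ToricCode3D.Face), ToricCode3D.BoundsPath γ S →
        ∃ α : ToricCode3D.Obs ≃⋆ₐ[ℂ] ToricCode3D.Obs,
          ToricCode3D.IsFluxAutomorphism S α ∧
          (ToricCode3D.IsGroundState (ToricCode3D.pullback ω α) ↔ γ.IsMonotonic) := by
  refine ⟨ToricCode3D.exists_vacuum, fun ω hω γ => ⟨ToricCode3D.exists_boundsPath γ,
    fun S hS => ?_⟩⟩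
  obtain ⟨α, hα⟩ := ToricCode3D.exists_limit_automorphism
    (T := fun n => (S n).image ToricCode3D.edgeOfDualFace)
    (fun _ _ h => Finset.image_subset_image (hS.1 h))
  have hφ := ToricCode3D.isFluxState_pullback hω hS hα
  exact ⟨α, hα, hφ.isMonotonic, hφ.isGroundState⟩
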